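/- **Model.** A bipartite graph $g$ has a set of users, a set of items and a set of edges, each joining a user to an item; $U(g)$, $I(g)$, $e(g)$ are the numbers of users, items and edges, and the edge density of $g$ is $\rho(g)=e(g)/(U(g)I(g))$ (set equal to $0$ if $g$ has no edge or is not finite). Let $(\mathcal X,\eta)$ and $(\mathcal Y,\nu)$ be $\sigma$-finite measure spaces (of finite or infinite total mass) and $W:\mathcal X\times\mathcal Y\to[0,1]$ a measurable function. Let the users $(X_i,U_i)_i$ be the points of a Poisson process on $\mathcal X\times\mathbb R_+$ with mean measure $\eta(\mathrm dX)\,\mathrm dU$, and the items $(Y_j,T_j)_j$ the points of an independent Poisson process on $\mathcal Y\times\mathbb R_+$ with mean measure $\nu(\mathrm dY)\,\mathrm dT$. Given the users and the items, join user $i$ to item $j$ with probability $W(X_i,Y_j)$, independently over all pairs $(i,j)$. For $s,\alpha>0$ let $G_{s,\alpha}$ be the subgraph induced by the users with label $U_i<s$ and the items with label $T_j<\alpha$, with its isolated vertices removed. The process $(G_{s,\alpha})$ is called *dense* if there is a constant $c>0$ such that almost surely $\rho(G_{s,\alpha})\to c$ as $s,\alpha\to\infty$ (that is, as $\min(s,\alpha)\to\infty$).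 **Sampling.** Let $p,q\in(0,1]$. Select each user with probability $p$ and each item with probability $q$, all selections being independent of one another and of the users, the items and the edges. The $(p,q)$-sampling $\mathrm{Smpl}_{p,q}(G_{s,\alpha})$ is the subgraph of $G_{s,\alpha}$ induced by its selected users and items, with the isolated vertices removed; the same selection is used for all $s,\alpha$. **Theorem.** If $(G_{s,\alpha})$ is dense, then for all $p,q\in(0,1]$, almost surely $$\lim_{s,\alpha\to\infty}\frac{\rho(\mathrm{Smpl}_{p,q}(G_{s,\alpha}))}{\rho(G_{s,\alpha})}=1 .$$ -/

import Mathlib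

open MeasureTheory ProbabilityTheory Filter Topology
open scoped NNReal ENNReal

/-- A bipartite graph: a set of users, a set of items, and a set of (unweighted) edges between
them. The vertex sets may be infinite; elements of `α` (of `β`) that do not belong to `users`
(to `items`) are not vertices. -/
@[ext]
structure BipartiteGraph (α β : Type*) where
  users : Set α
  items : Set β
  edges : Set (α × β)
  edges_subset : edges ⊆ users ×ˢ items

namespace BipartiteGraph

variable {α β : Type*}

/-- The subgraph induced by the users in `A` and the items in `B`. -/
def induce (g : BipartiteGraph α β) (A : Set α) (B : Set β) : BipartiteGraph α β where
  users := g.users ∩ A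
  items := g.items ∩ B
  edges := g.edges ∩ A ×ˢ B
  edges_subset := fun _ h =>
    ⟨⟨(g.edges_subset h.1).1, h.2.1⟩, ⟨(g.edges_subset h.1).2, h.2.2⟩⟩

/-- The graph with its isolated vertices removed. -/
def dropIsolated (g : BipartiteGraph α β) : BipartiteGraph α β where
  users := {u ∈ g.users | ∃ v, (u, v) ∈ g.edges}
  items := {v ∈ g.items | ∃ u, (u, v) ∈ g.edges}
  edges := g.edges
  edges_subset := fun x h =>
    ⟨⟨(g.edges_subset h).1, x.2, h⟩, ⟨(g.edges_subset h).2, x.1, h⟩⟩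

/-- The edge density `e(g) / (U(g) I(g))`. It has its usual meaning for a graph with finitely many
edges and at least one vertex of each kind; the value is `0` if the graph has no edge, and also if
it has infinitely many edges, users or items. -/
noncomputable def edgeDensity (g : BipartiteGraph α β) : ℝ :=
  (g.edges.ncard : ℝ) / ((g.users.ncard : ℝ) * (g.items.ncard : ℝ))

end BipartiteGraph

/-- `N` is a Poisson process (a Poisson random measure) with mean measure `m`: the number of points
in a measurable set `A` with `m A < ∞` is Poisson distributed with mean `m A`, and the numbers of
points in disjoint measurable sets are independent. -/
structure IsPoissonProcess {Ω E : Type*} [MeasurableSpace Ω] [MeasurableSpace E]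
    (N : Ω → Measure E) (m : Measure E) (P : Measure Ω) : Prop where
  measurable : Measurable N
  map_eq : ∀ A : Set E, MeasurableSet A → m A < ∞ →
    P.map (fun ω => N ω A) =
      (poissonMeasure (m A).toNNReal).map (fun k : ℕ => (k : ℝ≥0∞))
  indep : ∀ (n : ℕ) (A : Fin n → Set E), (∀ k, MeasurableSet (A k)) →
    Pairwise (fun k l => Disjoint (A k) (A l)) →
    iIndepFun (fun k ω => N ω (A k)) P

/-- The point process `∑ i, δ_{x i ω}` whose points are enumerated by the sequence `x`. -/
noncomputable def pointProcess {Ω E : Type*} [MeasurableSpace E] (x : ℕ → Ω → E) (ω : Ω) :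
    Measure E :=
  Measure.sum fun i => Measure.dirac (x i ω)

/-- The σ-algebra generated by two sequences of random points. -/
abbrev pointSigma {Ω E F : Type*} [MeasurableSpace E] [MeasurableSpace F]
    (x : ℕ → Ω → E) (y : ℕ → Ω → F) : MeasurableSpace Ω :=
  (⨆ i, MeasurableSpace.comap (x i) inferInstance) ⊔
    (⨆ j, MeasurableSpace.comap (y j) inferInstance)

/-- The bipartite exchangeable graph model with user feature space `(𝒳, η)`, item feature space
`(𝒴, ν)` and graphon `W`.

* `user i = (X i, U i)` are the feature and the label of user `i`; the users form a Poisson process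
  on `𝒳 × ℝ₊` with mean measure `η(dX) dU`.
* `item j = (Y j, T j)` are the feature and the label of item `j`; the items form an independent
  Poisson process on `𝒴 × ℝ₊` with mean measure `ν(dY) dT`.
* `edge ω` is the set of pairs `(i, j)` such that user `i` and item `j` are joined: given the
  users and the items, the edge indicators are independent Bernoulli variables with parameters
  `W (X i) (Y j)`. This is said by prescribing the conditional probability that all pairs of a
  finite set `F` are edges. -/
structure IsExchangeableGraphModel {Ω 𝒳 𝒴 : Type*} [MeasurableSpace Ω] [MeasurableSpace 𝒳]
    [MeasurableSpace 𝒴] (P : Measure Ω) (η : Measure 𝒳) (ν : Measure 𝒴) (W : 𝒳 → 𝒴 → ℝ)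
    (user : ℕ → Ω → 𝒳 × ℝ) (item : ℕ → Ω → 𝒴 × ℝ) (edge : Ω → Set (ℕ × ℕ)) : Prop where
  measurable_user : ∀ i, Measurable (user i)
  measurable_item : ∀ j, Measurable (item j)
  measurableSet_edge : ∀ i j, MeasurableSet {ω | (i, j) ∈ edge ω}
  poisson_user : IsPoissonProcess (pointProcess user)
    (η.prod ((volume : Measure ℝ).restrict (Set.Ici 0))) P
  poisson_item : IsPoissonProcess (pointProcess item)
    (ν.prod ((volume : Measure ℝ).restrict (Set.Ici 0))) P
  indep_user_item : IndepFun (pointProcess user) (pointProcess item) P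
  bernoulli_edge : ∀ F : Finset (ℕ × ℕ),
    P[Set.indicator {ω | ∀ x ∈ F, x ∈ edge ω} (fun _ => (1 : ℝ)) | pointSigma user item]
      =ᵐ[P] fun ω => ∏ x ∈ F, W (user x.1 ω).1 (item x.2 ω).1

/-- The infinite bipartite graph on all users and all items with edge set `E`. -/
def fullGraph (E : Set (ℕ × ℕ)) : BipartiteGraph ℕ ℕ where
  users := Set.univ
  items := Set.univ
  edges := E
  edges_subset := fun _ _ => ⟨trivial, trivial⟩

/-- The graph `G_{s,a}` of user-size `s` and item-size `a`: restrict to the users with label `< s`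
and the items with label `< a`, then remove the isolated vertices. -/
def graphProcess {Ω 𝒳 𝒴 : Type*} (user : ℕ → Ω → 𝒳 × ℝ) (item : ℕ → Ω → 𝒴 × ℝ)
    (edge : Ω → Set (ℕ × ℕ)) (s a : ℝ) (ω : Ω) : BipartiteGraph ℕ ℕ :=
  ((fullGraph (edge ω)).induce {i | (user i ω).2 < s} {j | (item j ω).2 < a}).dropIsolated

/-- The graph process `G` is dense: almost surely its edge density converges, as both sizes tend
to infinity, to a (nonrandom) positive constant. -/
def IsDenseProcess {Ω : Type*} [MeasurableSpace Ω] (P : Measure Ω)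
    (G : ℝ → ℝ → Ω → BipartiteGraph ℕ ℕ) : Prop :=
  ∃ c : ℝ, 0 < c ∧ ∀ᵐ ω ∂P,
    Tendsto (fun z : ℝ × ℝ => (G z.1 z.2 ω).edgeDensity) (atTop ×ˢ atTop) (𝓝 c)

/-- `A` and `B` are the random sets of selected users and items of `(p, q)`-sampling, where the
graph to be sampled depends on the random variable `D`: each user is selected with probability `p`,
each item with probability `q`, all these selections are independent of one another, and they are
jointly independent of `D`. -/
structure IsSelection {Ω 𝒟 : Type*} [MeasurableSpace Ω] [MeasurableSpace 𝒟] (P : Measure Ω)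
    (p q : ℝ) (D : Ω → 𝒟) (A B : Ω → Set ℕ) : Prop where
  measurableSet_user : ∀ i, MeasurableSet {ω | i ∈ A ω}
  measurableSet_item : ∀ j, MeasurableSet {ω | j ∈ B ω}
  prob_user : ∀ i, P {ω | i ∈ A ω} = ENNReal.ofReal p
  prob_item : ∀ j, P {ω | j ∈ B ω} = ENNReal.ofReal q
  indep : iIndepSet (Sum.elim (fun i : ℕ => {ω | i ∈ A ω}) (fun j : ℕ => {ω | j ∈ B ω})) P
  indep_data : IndepFun (fun ω => (A ω, B ω)) D P

/-- The subgraph obtained by sampling: keep the selected users and items, take the induced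
subgraph and remove its isolated vertices. -/
def BipartiteGraph.sample {α β : Type*} (g : BipartiteGraph α β) (A : Set α) (B : Set β) :
    BipartiteGraph α β :=
  (g.induce A B).dropIsolated

/-!
The sampled graph process is, up to a change of the two sizes, a copy in law of the original one:
keeping each point of a Poisson process on `𝒳 × ℝ₊` with probability `p` and multiplying its label
by `p` gives back a Poisson process with the same mean measure. Hence the sampled graph of sizes
`(s, a)` is distributed, jointly in `s` and `a`, as the full graph of sizes `(p s, q a)`. Since the
limit `c` of the edge density is nonrandom and convergence to `c` is a property of the law of the
process, the density of the sampled graph also tends to `c` almost surely. As `c ≠ 0`, the ratio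
of the densities tends to `1`. No description of the dense graphons is needed.

The users and items come as sequences whose enumeration may depend on anything, so the comparison
of laws has to be made for objects that do not see the enumeration. The object chosen is the random
set `labelEdges` of the pairs of rescaled labels of the edges between selected vertices.

* Labels are almost surely distinct (`ae_injective_label`), so the edge density can be read off from
  `labelEdges` (`edgeDensity_sample_graphProcess`).
* The law of a random set is determined by its avoidance probabilities (`HitSet.map_eq_of_avoid`),
  and edge densities are measurable functions of the set (`HitSet.measurable_density`).
* Given the users, the items and the selections, the probability that `labelEdges` avoids a set `V`
  is `exp (-∬ h dN dM)`, where `N` and `M` are the point processes of selected users and items and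
  `h = -log (1 - W 1_V)`. This follows from the conditional moments of the edge indicators by
  inclusion and exclusion (`IsExchangeableGraphModel.measureReal_no_edge`).
* The joint Laplace functional of `N` and `M` does not depend on `p` and `q`
  (`IsExchangeableGraphModel.integral_expNeg_selectedProcess`). It determines the joint law of `N`
  and `M`, hence the expectation of `exp (-∬ h dN dM)` (`integral_expNeg_lintegral_lintegral_eq`).

All this applies to the full graph as well: it is the case `p = q = 1` with all vertices selected.
-/

/-! ### The function `e⁻ˣ` on `[0, ∞]` -/

/-- The function `x ↦ e⁻ˣ` on `[0, ∞]`, with `e^(-∞) = 0`. -/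
noncomputable def expNeg (x : ℝ≥0∞) : ℝ := (EReal.exp (-(x : EReal))).toReal

/-- The inverse `t ↦ -log t` of `expNeg` on `[0, 1]`, with value `∞` for `t ≤ 0` (and with the
truncated value `0` for `t > 1`). -/
noncomputable def negLog (t : ℝ) : ℝ≥0∞ := if t ≤ 0 then ∞ else ENNReal.ofReal (-Real.log t)

theorem expNeg_exp_ne_top (x : ℝ≥0∞) : EReal.exp (-(x : EReal)) ≠ ∞ := by
  rw [Ne, EReal.exp_eq_top_iff, EReal.neg_eq_top_iff]
  exact EReal.coe_ennreal_ne_bot x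

theorem expNeg_top : expNeg ∞ = 0 := by simp [expNeg]

theorem expNeg_zero : expNeg 0 = 1 := by simp [expNeg]

theorem expNeg_of_ne_top {x : ℝ≥0∞} (hx : x ≠ ∞) : expNeg x = Real.exp (-x.toReal) := by
  lift x to ℝ≥0 using hx
  rw [expNeg, EReal.coe_nnreal_eq_coe_real, ← EReal.coe_neg, EReal.exp_coe,
    ENNReal.toReal_ofReal (Real.exp_pos _).le, ENNReal.coe_toReal]

theorem expNeg_nonneg (x : ℝ≥0∞) : 0 ≤ expNeg x := ENNReal.toReal_nonneg

theorem expNeg_le_one (x : ℝ≥0∞) : expNeg x ≤ 1 := by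
  rcases eq_or_ne x ∞ with rfl | hx
  · simp [expNeg_top]
  · rw [expNeg_of_ne_top hx]
    simp

theorem expNeg_add (x y : ℝ≥0∞) : expNeg (x + y) = expNeg x * expNeg y := by
  rcases eq_or_ne x ∞ with rfl | hx
  · simp [expNeg_top]
  rcases eq_or_ne y ∞ with rfl | hy
  · simp [expNeg_top]
  rw [expNeg_of_ne_top hx, expNeg_of_ne_top hy, expNeg_of_ne_top (ENNReal.add_ne_top.2 ⟨hx, hy⟩),
    ENNReal.toReal_add hx hy, neg_add, Real.exp_add]

theorem expNeg_sum {ι : Type*} (s : Finset ι) (f : ι → ℝ≥0∞) :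
    expNeg (∑ i ∈ s, f i) = ∏ i ∈ s, expNeg (f i) := by
  classical
  induction s using Finset.induction_on with
  | empty => simp [expNeg_zero]
  | insert a s ha ih => rw [Finset.sum_insert ha, Finset.prod_insert ha, expNeg_add, ih]

theorem continuous_expNeg : Continuous expNeg := by
  refine ENNReal.continuousOn_toReal.comp_continuous ?_ expNeg_exp_ne_top
  exact ENNReal.continuous_exp.comp (continuous_neg.comp continuous_coe_ennreal_ereal)

theorem measurable_expNeg : Measurable expNeg := continuous_expNeg.measurable

theorem norm_expNeg_le_one (x : ℝ≥0∞) : ‖expNeg x‖ ≤ 1 := by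
  rw [Real.norm_of_nonneg (expNeg_nonneg x)]
  exact expNeg_le_one x

theorem expNeg_mem_Icc (x : ℝ≥0∞) : expNeg x ∈ Set.Icc (0 : ℝ) 1 :=
  ⟨expNeg_nonneg x, expNeg_le_one x⟩

theorem expNeg_antitone : Antitone expNeg := by
  intro x y hxy
  refine ENNReal.toReal_mono (expNeg_exp_ne_top x) (EReal.exp_monotone ?_)
  exact EReal.neg_le_neg_iff.2 (EReal.coe_ennreal_le_coe_ennreal_iff.2 hxy)

theorem expNeg_negLog {t : ℝ} (h0 : 0 ≤ t) (h1 : t ≤ 1) : expNeg (negLog t) = t := by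
  rcases h0.eq_or_lt with rfl | h
  · simp [negLog, expNeg_top]
  · rw [negLog, if_neg h.not_ge, expNeg_of_ne_top ENNReal.ofReal_ne_top,
      ENNReal.toReal_ofReal (neg_nonneg.2 (Real.log_nonpos h0 h1)), neg_neg, Real.exp_log h]

theorem negLog_expNeg (x : ℝ≥0∞) : negLog (expNeg x) = x := by
  rcases eq_or_ne x ∞ with rfl | hx
  · simp [negLog, expNeg_top]
  · rw [expNeg_of_ne_top hx, negLog, if_neg (Real.exp_pos _).not_ge, Real.log_exp, neg_neg,
      ENNReal.ofReal_toReal hx]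

theorem measurable_negLog : Measurable negLog := by
  refine Measurable.ite measurableSet_Iic measurable_const ?_
  fun_prop

/-- Dominated convergence for Laplace transforms. -/
theorem tendsto_integral_expNeg {Ω : Type*} [MeasurableSpace Ω] {P : Measure Ω}
    [IsFiniteMeasure P] {F : ℕ → Ω → ℝ≥0∞} {f : Ω → ℝ≥0∞} (hF : ∀ n, AEMeasurable (F n) P)
    (h : ∀ᵐ ω ∂P, Tendsto (fun n => F n ω) atTop (𝓝 (f ω))) :
    Tendsto (fun n => ∫ ω, expNeg (F n ω) ∂P) atTop (𝓝 (∫ ω, expNeg (f ω) ∂P)) := by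
  refine tendsto_integral_of_dominated_convergence (fun _ => 1)
    (fun n => (measurable_expNeg.comp_aemeasurable (hF n)).aestronglyMeasurable)
    (integrable_const 1) (fun n => Eventually.of_forall fun _ => norm_expNeg_le_one _) ?_
  filter_upwards [h] with ω hω using (continuous_expNeg.tendsto _).comp hω

/-! ### Probability measures determined by a multiplicative family of functions -/

/-- A family of measurable `[0, 1]`-valued functions, closed under multiplication and generating
the σ-algebra, determines probability measures: finitely many of the functions map into a compact
cube, on which polynomials are dense. -/
theorem Measure.ext_of_integral_multiplicative {S ι : Type*} [mS : MeasurableSpace S]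
    {L L' : Measure S} [IsProbabilityMeasure L] [IsProbabilityMeasure L'] (φ : ι → S → ℝ)
    (hφ : ∀ i, Measurable (φ i)) (hφ01 : ∀ i s, φ i s ∈ Set.Icc (0 : ℝ) 1)
    (hone : ∃ i, φ i = 1) (hmul : ∀ i j, ∃ k, φ k = φ i * φ j)
    (hgen : mS ≤ ⨆ i, MeasurableSpace.comap (φ i) inferInstance)
    (h : ∀ i, ∫ s, φ i s ∂L = ∫ s, φ i s ∂L') : L = L' := by
  classical
  let ψ : S → ι → unitInterval := fun s i => ⟨φ i s, hφ01 i s⟩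
  have hψ : Measurable ψ := measurable_pi_lambda _ fun i => (hφ i).subtype_mk
  have key : L.map ψ = L'.map ψ := by
    have := Measure.isProbabilityMeasure_map (μ := L) hψ.aemeasurable
    have := Measure.isProbabilityMeasure_map (μ := L') hψ.aemeasurable
    have hr : ∀ I : Finset ι, Measurable (I.restrict : (ι → unitInterval) → _) := fun I =>
      measurable_pi_lambda _ fun _ => measurable_pi_apply _
    have hfin : ∀ I : Finset ι, IsProbabilityMeasure ((L'.map ψ).map I.restrict) := fun I =>
      Measure.isProbabilityMeasure_map (hr I).aemeasurable
    refine IsProjectiveLimit.unique (P := fun I => (L'.map ψ).map I.restrict) ?_ (fun I => rfl)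
    intro I
    have : IsProbabilityMeasure ((L.map ψ).map I.restrict) :=
      Measure.isProbabilityMeasure_map (hr I).aemeasurable
    -- The elements of the algebra generated by the coordinates are linear combinations of
    -- monomials, and a monomial in the functions `φ i` is again one of them.
    let co : I → BoundedContinuousFunction (I → unitInterval) ℝ := fun i =>
      BoundedContinuousFunction.mkOfCompact ⟨fun x => (x i : ℝ), by fun_prop⟩
    let A : StarSubalgebra ℝ (BoundedContinuousFunction (I → unitInterval) ℝ) :=
      { Algebra.adjoin ℝ (Set.range co) with
        star_mem' := fun {a} ha => by
          have : star a = a := by ext x; simp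
          rw [this]; exact ha }
    refine ext_of_forall_mem_subalgebra_integral_eq_of_pseudoEMetric_complete_countable (𝕜 := ℝ)
      (A := A) ?_ ?_
    · intro x y hxy
      obtain ⟨i, hi⟩ := Function.ne_iff.1 hxy
      refine ⟨co i, ⟨(co i).toContinuousMap, ⟨co i, Algebra.subset_adjoin ⟨i, rfl⟩, rfl⟩, rfl⟩, ?_⟩
      exact fun h => hi (Subtype.ext h)
    · intro g hg
      have hg' : g ∈ Algebra.adjoin ℝ (Set.range co) := hg
      have hg2 : g ∈ Submodule.span ℝ (Submonoid.closure (Set.range co) : Set _) := by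
        rw [← Algebra.adjoin_eq_span]; exact hg'
      induction hg2 using Submodule.span_induction with
      | zero => simp
      | add a b ha hb iha ihb =>
        rw [← Algebra.adjoin_eq_span] at ha hb
        simp only [BoundedContinuousFunction.coe_add, Pi.add_apply]
        rw [integral_add (a.integrable _) (b.integrable _),
          integral_add (a.integrable _) (b.integrable _), iha ha ha, ihb hb hb]
      | smul c a ha iha =>
        rw [← Algebra.adjoin_eq_span] at ha
        simp only [BoundedContinuousFunction.coe_smul, integral_const_mul, smul_eq_mul]
        rw [iha ha ha]
      | mem m hm =>
        obtain ⟨k, hk⟩ : ∃ k, ∀ s, m (I.restrict (ψ s)) = φ k s := by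
          clear hg hg'
          induction hm using Submonoid.closure_induction with
          | mem m hm =>
            obtain ⟨i, rfl⟩ := hm
            exact ⟨i, fun s => rfl⟩
          | one =>
            obtain ⟨i, hi⟩ := hone
            exact ⟨i, fun s => by simp [hi]⟩
          | mul a b _ _ iha ihb =>
            obtain ⟨i, hi⟩ := iha
            obtain ⟨j, hj⟩ := ihb
            obtain ⟨k, hk⟩ := hmul i j
            exact ⟨k, fun s => by simp [hk, hi, hj]⟩
        have hm' : ∀ M : Measure _, AEStronglyMeasurable (fun x => m x) M := fun M =>
          m.continuous.measurable.aestronglyMeasurable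
        have e : ∀ M : Measure S, ∫ x, m x ∂((M.map ψ).map I.restrict) = ∫ s, φ k s ∂M := by
          intro M
          rw [integral_map (hr I).aemeasurable (hm' _),
            integral_map (f := fun x => m (I.restrict x)) hψ.aemeasurable
            (m.continuous.measurable.comp (hr I)).aestronglyMeasurable]
          exact integral_congr_ae (Eventually.of_forall hk)
        rw [e, e, h k]
  ext s hs
  have hs' : MeasurableSet[MeasurableSpace.comap ψ inferInstance] s := by
    refine (hgen.trans (iSup_le fun i => ?_)) s hs
    rintro _ ⟨t, ht, rfl⟩
    refine ⟨(fun x => (x i : ℝ)) ⁻¹' t, ?_, rfl⟩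
    exact (measurable_subtype_coe.comp (measurable_pi_apply i)) ht
  obtain ⟨t, ht, rfl⟩ := hs'
  rw [← Measure.map_apply hψ ht, ← Measure.map_apply hψ ht, key]

/-! ### The Laplace functional of a Poisson process -/

theorem expNeg_mul_natCast (c : ℝ≥0∞) (k : ℕ) : expNeg (c * k) = expNeg c ^ k := by
  have := expNeg_sum (Finset.range k) fun _ => c
  simpa [mul_comm] using this

/-- The probability generating function of the Poisson distribution. -/
theorem integral_pow_poissonMeasure (r : ℝ≥0) (t : ℝ) :
    ∫ k, t ^ k ∂(poissonMeasure r) = Real.exp (-(r * (1 - t))) := by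
  rw [integral_poissonMeasure]
  have h : ∀ n : ℕ, (Real.exp (-r) * r ^ n / n.factorial) • t ^ n
      = Real.exp (-r) * ((r * t) ^ n / n.factorial) := fun n => by
    rw [smul_eq_mul, mul_pow]; ring
  simp_rw [h]
  rw [tsum_mul_left, ← congrFun NormedSpace.exp_eq_tsum_div, ← Real.exp_eq_exp_ℝ, ← Real.exp_add]
  congr 1
  ring

namespace IsPoissonProcess

variable {Ω E : Type*} [MeasurableSpace Ω] [MeasurableSpace E] {P : Measure Ω}
  {N : Ω → Measure E} {m : Measure E}

theorem measurable_apply (hN : IsPoissonProcess N m P) {A : Set E} (hA : MeasurableSet A) :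
    Measurable fun ω => N ω A := (Measure.measurable_coe hA).comp hN.measurable

theorem integral_expNeg_mul (hN : IsPoissonProcess N m P) {A : Set E} (hA : MeasurableSet A)
    (hm : m A < ∞) (c : ℝ≥0∞) :
    ∫ ω, expNeg (c * N ω A) ∂P = expNeg (ENNReal.ofReal (1 - expNeg c) * m A) := by
  have h1 : ∫ ω, expNeg (c * N ω A) ∂P = ∫ x, expNeg (c * x) ∂(P.map fun ω => N ω A) :=
    (integral_map (hN.measurable_apply hA).aemeasurable
      (measurable_expNeg.comp (measurable_const.mul measurable_id)).aestronglyMeasurable).symm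
  rw [h1, hN.map_eq A hA hm, integral_map (f := fun x => expNeg (c * x))
    (Measurable.of_discrete).aemeasurable
    (measurable_expNeg.comp (measurable_const.mul measurable_id)).aestronglyMeasurable]
  simp_rw [expNeg_mul_natCast]
  have h0 := sub_nonneg.2 (expNeg_le_one c)
  rw [integral_pow_poissonMeasure, expNeg_of_ne_top
    (ENNReal.mul_ne_top ENNReal.ofReal_ne_top hm.ne), ENNReal.toReal_mul, ENNReal.toReal_ofReal h0,
    ENNReal.coe_toNNReal_eq_toReal, mul_comm]

theorem integral_expNeg_lintegral_simpleFunc (hN : IsPoissonProcess N m P)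
    [IsProbabilityMeasure P] (f : SimpleFunc E ℝ≥0∞) (hf : ∀ c ≠ 0, m (f ⁻¹' {c}) < ∞) :
    ∫ ω, expNeg (∫⁻ x, f x ∂(N ω)) ∂P = expNeg (∫⁻ x, ENNReal.ofReal (1 - expNeg (f x)) ∂m) := by
  let e := f.range.equivFin
  have hind := hN.indep f.range.card (fun k => f ⁻¹' {(e.symm k : ℝ≥0∞)})
    (fun k => f.measurableSet_preimage _) (fun k l hkl => by
      refine Disjoint.preimage _ (Set.disjoint_singleton.2 fun h => hkl ?_)
      exact e.symm.injective (Subtype.ext h))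
  have hsum : ∀ ω, expNeg (∫⁻ x, f x ∂(N ω))
      = ∏ k, expNeg ((e.symm k : ℝ≥0∞) * N ω (f ⁻¹' {(e.symm k : ℝ≥0∞)})) := by
    intro ω
    rw [SimpleFunc.lintegral_eq_lintegral, SimpleFunc.lintegral, expNeg_sum,
      ← Finset.prod_coe_sort]
    exact (Equiv.prod_comp e.symm
      (fun c : f.range => expNeg ((c : ℝ≥0∞) * N ω (f ⁻¹' {(c : ℝ≥0∞)})))).symm
  have hmap : ∫⁻ x, ENNReal.ofReal (1 - expNeg (f x)) ∂m
      = ∑ c ∈ f.range, ENNReal.ofReal (1 - expNeg c) * m (f ⁻¹' {c}) := by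
    rw [← SimpleFunc.map_lintegral (fun c => ENNReal.ofReal (1 - expNeg c)) f,
      ← SimpleFunc.lintegral_eq_lintegral]
    rfl
  simp_rw [hsum]
  rw [hind.integral_fun_prod_comp
    (f := fun k x => expNeg ((e.symm k : ℝ≥0∞) * x))
    (fun k => (hN.measurable_apply (f.measurableSet_preimage _)).aemeasurable)
    (fun k => (measurable_expNeg.comp (measurable_const.mul measurable_id)).aestronglyMeasurable),
    hmap, expNeg_sum, ← Finset.prod_coe_sort f.range, ← Equiv.prod_comp e.symm]
  refine Finset.prod_congr rfl fun k _ => ?_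
  rcases eq_or_ne (e.symm k : ℝ≥0∞) 0 with h0 | h0
  · simp [h0, expNeg_zero]
  · exact hN.integral_expNeg_mul (f.measurableSet_preimage _) (hf _ h0) _

/-- The Laplace functional of a Poisson process. -/
theorem integral_expNeg_lintegral (hN : IsPoissonProcess N m P) [IsProbabilityMeasure P]
    [SigmaFinite m] {f : E → ℝ≥0∞} (hf : Measurable f) :
    ∫ ω, expNeg (∫⁻ x, f x ∂(N ω)) ∂P = expNeg (∫⁻ x, ENNReal.ofReal (1 - expNeg (f x)) ∂m) := by
  -- Simple functions with support of finite mean measure, increasing to `f`.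
  let s : ℕ → SimpleFunc E ℝ≥0∞ := fun n => (SimpleFunc.eapprox f n).restrict (spanningSets m n)
  have hs : ∀ n x, s n x = (spanningSets m n).indicator (SimpleFunc.eapprox f n) x := fun n x =>
    SimpleFunc.restrict_apply _ (measurableSet_spanningSets m n) x
  have hmono : ∀ x, Monotone fun n => s n x := by
    intro x n k hnk
    simp only [hs]
    by_cases hx : x ∈ spanningSets m n
    · rw [Set.indicator_of_mem hx, Set.indicator_of_mem (monotone_spanningSets m hnk hx)]
      exact SimpleFunc.monotone_eapprox f hnk x
    · rw [Set.indicator_of_notMem hx]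
      exact zero_le
  have hlim : ∀ x, Tendsto (fun n => s n x) atTop (𝓝 (f x)) := by
    intro x
    refine (SimpleFunc.tendsto_eapprox hf x).congr' ?_
    filter_upwards [eventually_ge_atTop (spanningSetsIndex m x)] with n hn
    rw [hs, Set.indicator_of_mem (mem_spanningSets_of_index_le m x hn)]
  have hfin : ∀ n, ∀ c ≠ 0, m (s n ⁻¹' {c}) < ∞ := by
    intro n c hc
    refine (measure_mono fun x hx => ?_).trans_lt (measure_spanningSets_lt_top m n)
    by_contra hx'
    rw [Set.mem_preimage, hs, Set.indicator_of_notMem hx'] at hx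
    exact hc hx.symm
  have hL := tendsto_integral_expNeg (P := P) (F := fun n ω => ∫⁻ x, s n x ∂(N ω))
    (f := fun ω => ∫⁻ x, f x ∂(N ω))
    (fun n => ((Measure.measurable_lintegral (s n).measurable).comp hN.measurable).aemeasurable)
    (Eventually.of_forall fun ω => lintegral_tendsto_of_tendsto_of_monotone
      (fun n => (s n).measurable.aemeasurable) (Eventually.of_forall hmono)
      (Eventually.of_forall hlim))
  have hc : Continuous fun c : ℝ≥0∞ => ENNReal.ofReal (1 - expNeg c) :=
    ENNReal.continuous_ofReal.comp (continuous_const.sub continuous_expNeg)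
  have hR : Tendsto (fun n => expNeg (∫⁻ x, ENNReal.ofReal (1 - expNeg (s n x)) ∂m)) atTop
      (𝓝 (expNeg (∫⁻ x, ENNReal.ofReal (1 - expNeg (f x)) ∂m))) := by
    refine (continuous_expNeg.tendsto _).comp (lintegral_tendsto_of_tendsto_of_monotone
      (fun n => (hc.measurable.comp (s n).measurable).aemeasurable) (Eventually.of_forall ?_)
      (Eventually.of_forall fun x => (hc.tendsto _).comp (hlim x)))
    intro x n k hnk
    exact ENNReal.ofReal_le_ofReal (sub_le_sub_left (expNeg_antitone (hmono x hnk)) 1)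
  refine tendsto_nhds_unique hL (hR.congr fun n => ?_)
  exact (hN.integral_expNeg_lintegral_simpleFunc (s n) (hfin n)).symm

theorem ae_lt_top (hN : IsPoissonProcess N m P) {A : Set E} (hA : MeasurableSet A)
    (hm : m A < ∞) : ∀ᵐ ω ∂P, N ω A < ∞ := by
  have : ∀ᵐ x ∂(P.map fun ω => N ω A), x < ∞ := by
    rw [hN.map_eq A hA hm, ae_map_iff (Measurable.of_discrete).aemeasurable measurableSet_Iio]
    exact Eventually.of_forall fun k => ENNReal.natCast_lt_top k
  exact ae_of_ae_map (hN.measurable_apply hA).aemeasurable this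

/-- A Poisson variable with mean `r` exceeds `1` with probability `1 - e⁻ʳ(1 + r) ≤ r²`. -/
theorem measure_two_le (hN : IsPoissonProcess N m P) {A : Set E} (hA : MeasurableSet A)
    (hm : m A < ∞) : P {ω | 2 ≤ N ω A} ≤ m A ^ 2 := by
  have h1 : P {ω | 2 ≤ N ω A} = (P.map fun ω => N ω A) (Set.Ici 2) := by
    rw [Measure.map_apply (hN.measurable_apply hA) measurableSet_Ici]; rfl
  have h2 : (fun k : ℕ => (k : ℝ≥0∞)) ⁻¹' Set.Ici 2 = ({0, 1} : Set ℕ)ᶜ := by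
    ext k
    simp only [Set.mem_preimage, Set.mem_Ici, Set.mem_compl_iff, Set.mem_insert_iff,
      Set.mem_singleton_iff]
    rw [← Nat.cast_two, Nat.cast_le]
    omega
  set r : ℝ≥0 := (m A).toNNReal with hr
  have hmr : m A = r := (ENNReal.coe_toNNReal hm.ne).symm
  have h3 : (poissonMeasure r).real {0, 1} = Real.exp (-r) * (1 + r) := by
    rw [Set.insert_eq, measureReal_union (Set.disjoint_singleton.2 zero_ne_one)
      (measurableSet_singleton 1),
      poissonMeasure_real_singleton, poissonMeasure_real_singleton]
    simp
    ring
  rw [h1, hN.map_eq A hA hm, Measure.map_apply Measurable.of_discrete measurableSet_Ici, h2,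
    ← hr, hmr]
  have h4 : (poissonMeasure r).real ({0, 1} : Set ℕ)ᶜ ≤ (r : ℝ) ^ 2 := by
    rw [measureReal_compl (Set.toFinite _).measurableSet, h3, probReal_univ]
    have := Real.add_one_le_exp (-(r : ℝ))
    nlinarith [r.coe_nonneg]
  rw [← ENNReal.ofReal_toReal (measure_ne_top (poissonMeasure r) _)]
  calc ENNReal.ofReal _ ≤ ENNReal.ofReal ((r : ℝ) ^ 2) := ENNReal.ofReal_le_ofReal h4
    _ = (r : ℝ≥0∞) ^ 2 := by
      rw [ENNReal.ofReal_pow r.coe_nonneg, ENNReal.ofReal_coe_nnreal]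

end IsPoissonProcess

/-! ### The joint law of two random measures -/

/-- The joint law of two random measures is determined by their joint Laplace functional. -/
theorem map_prodMk_eq_of_integral_expNeg {Ω Ω' E F : Type*} [MeasurableSpace Ω]
    [MeasurableSpace Ω'] [MeasurableSpace E] [MeasurableSpace F] {P : Measure Ω} {P' : Measure Ω'}
    [IsProbabilityMeasure P] [IsProbabilityMeasure P']
    {N : Ω → Measure E} {M : Ω → Measure F} {N' : Ω' → Measure E} {M' : Ω' → Measure F}
    (hN : Measurable N) (hM : Measurable M) (hN' : Measurable N') (hM' : Measurable M')
    (h : ∀ (f : E → ℝ≥0∞) (g : F → ℝ≥0∞), Measurable f → Measurable g →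
      ∫ ω, expNeg (∫⁻ x, f x ∂(N ω) + ∫⁻ y, g y ∂(M ω)) ∂P
        = ∫ ω, expNeg (∫⁻ x, f x ∂(N' ω) + ∫⁻ y, g y ∂(M' ω)) ∂P') :
    P.map (fun ω => (N ω, M ω)) = P'.map (fun ω => (N' ω, M' ω)) := by
  have := Measure.isProbabilityMeasure_map (μ := P) (hN.prodMk hM).aemeasurable
  have := Measure.isProbabilityMeasure_map (μ := P') (hN'.prodMk hM').aemeasurable
  let I := {f : E → ℝ≥0∞ // Measurable f} × {g : F → ℝ≥0∞ // Measurable g}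
  let φ : I → Measure E × Measure F → ℝ := fun i z =>
    expNeg (∫⁻ x, i.1.1 x ∂z.1 + ∫⁻ y, i.2.1 y ∂z.2)
  have hφ : ∀ i, Measurable (φ i) := fun i => measurable_expNeg.comp
    (((Measure.measurable_lintegral i.1.2).comp measurable_fst).add
      ((Measure.measurable_lintegral i.2.2).comp measurable_snd))
  have hcomap : ∀ i, @Measurable _ _ (⨆ i, MeasurableSpace.comap (φ i) inferInstance) _ (φ i) :=
    fun i => Measurable.mono (comap_measurable _)
      (le_iSup (fun i => MeasurableSpace.comap (φ i) inferInstance) i) le_rfl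
  refine Measure.ext_of_integral_multiplicative φ hφ (fun i z => expNeg_mem_Icc _)
    ⟨(⟨0, measurable_zero⟩, ⟨0, measurable_zero⟩), ?_⟩ (fun i j => ?_) ?_ (fun i => ?_)
  · ext z
    simp [φ, expNeg_zero]
  · refine ⟨(⟨i.1.1 + j.1.1, i.1.2.add j.1.2⟩, ⟨i.2.1 + j.2.1, i.2.2.add j.2.2⟩), ?_⟩
    ext z
    simp only [φ, Pi.mul_apply, Pi.add_apply, ← expNeg_add]
    rw [lintegral_add_left i.1.2, lintegral_add_left i.2.2]
    congr 1
    ring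
  · -- `μ s` is recovered from the Laplace functional at the indicator of `s`.
    refine sup_le (Measurable.comap_le ?_) (Measurable.comap_le ?_)
    · refine Measure.measurable_of_measurable_coe _ fun s hs => ?_
      have := measurable_negLog.comp
        (hcomap (⟨s.indicator 1, measurable_one.indicator hs⟩, ⟨0, measurable_zero⟩))
      convert this using 2 with z
      simp [φ, negLog_expNeg, lintegral_indicator_one hs]
    · refine Measure.measurable_of_measurable_coe _ fun s hs => ?_
      have := measurable_negLog.comp
        (hcomap (⟨0, measurable_zero⟩, ⟨s.indicator 1, measurable_one.indicator hs⟩))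
      convert this using 2 with z
      simp [φ, negLog_expNeg, lintegral_indicator_one hs]
  · rw [integral_map (hN.prodMk hM).aemeasurable (hφ i).aestronglyMeasurable,
      integral_map (hN'.prodMk hM').aemeasurable (hφ i).aestronglyMeasurable]
    exact h _ _ i.1.2 i.2.2

section Kernel

variable {E : Type*} [MeasurableSpace E]

/-- The identity of `Measure E`, as a kernel. It is not s-finite in general, so that the
measurability of integrals with respect to a kernel does not apply to it directly. -/
noncomputable def evalKernel (E : Type*) [MeasurableSpace E] : Kernel (Measure E) E :=
  ⟨id, measurable_id⟩

theorem measurableSet_le_measure_lt {C : Set E} (hC : MeasurableSet C) (k : ℕ) :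
    MeasurableSet {μ : Measure E | (k : ℝ≥0∞) ≤ μ C ∧ μ C < k + 1} :=
  (measurableSet_le measurable_const (Measure.measurable_coe hC)).inter
    (measurableSet_lt (Measure.measurable_coe hC) measurable_const)

open Classical in
/-- The kernel that maps `μ` to its restriction to `C` if `k ≤ μ C < k + 1`, and to `0`
otherwise. -/
noncomputable def pieceKernel {C : Set E} (hC : MeasurableSet C) (k : ℕ) :
    Kernel (Measure E) E :=
  Kernel.piecewise (measurableSet_le_measure_lt hC k) ((evalKernel E).restrict hC) 0

instance {C : Set E} (hC : MeasurableSet C) (k : ℕ) : IsFiniteKernel (pieceKernel hC k) := by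
  refine ⟨k + 1, by simp, fun μ => ?_⟩
  rw [pieceKernel, Kernel.piecewise_apply]
  split_ifs with h
  · rw [Kernel.restrict_apply, Measure.restrict_apply MeasurableSet.univ, Set.univ_inter]
    exact h.2.le
  · simp

/-- An s-finite kernel that fixes the measures for which all sets `C n` have finite measure, if the
`C n` are a partition of the space. -/
noncomputable def partitionKernel {C : ℕ → Set E} (hC : ∀ n, MeasurableSet (C n)) :
    Kernel (Measure E) E :=
  Kernel.sum fun nk : ℕ × ℕ => pieceKernel (hC nk.1) nk.2

instance {C : ℕ → Set E} (hC : ∀ n, MeasurableSet (C n)) :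
    IsSFiniteKernel (partitionKernel hC) := by
  unfold partitionKernel; infer_instance

theorem partitionKernel_apply {C : ℕ → Set E} (hC : ∀ n, MeasurableSet (C n))
    (hdisj : Pairwise (Function.onFun Disjoint C)) (hcover : ⋃ n, C n = Set.univ) {μ : Measure E}
    (hμ : ∀ n, μ (C n) < ∞) : partitionKernel hC μ = μ := by
  ext s hs
  have hpiece : ∀ n, ∑' k, pieceKernel (hC n) k μ s = μ (s ∩ C n) := by
    intro n
    have hk : ∀ k : ℕ, ((k : ℝ≥0∞) ≤ μ (C n) ∧ μ (C n) < k + 1) ↔ k = ⌊(μ (C n)).toReal⌋₊ := by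
      intro k
      obtain ⟨r, hr⟩ : ∃ r : ℝ≥0, (r : ℝ≥0∞) = μ (C n) := ⟨_, ENNReal.coe_toNNReal (hμ n).ne⟩
      rw [← hr, eq_comm, Nat.floor_eq_iff (by positivity)]
      norm_cast
    rw [tsum_eq_single ⌊(μ (C n)).toReal⌋₊]
    · rw [pieceKernel, Kernel.piecewise_apply, if_pos (by exact (hk _).2 rfl),
        Kernel.restrict_apply, Measure.restrict_apply hs]
      rfl
    · intro k hk'
      rw [pieceKernel, Kernel.piecewise_apply, if_neg (by exact fun h => hk' ((hk k).1 h))]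
      simp
  rw [partitionKernel, Kernel.sum_apply' _ _ hs,
    ENNReal.tsum_prod (f := fun n k => pieceKernel (hC n) k μ s)]
  simp_rw [hpiece]
  rw [← measure_iUnion (fun i j hij => ((hdisj hij).mono Set.inter_subset_right
    Set.inter_subset_right)) (fun n => hs.inter (hC n)), ← Set.inter_iUnion, hcover,
    Set.inter_univ]

theorem Measurable.lintegral_lintegral_kernel {F : Type*} [MeasurableSpace F]
    {α β : Type*} [MeasurableSpace α] [MeasurableSpace β]
    (κ : Kernel α E) (κ' : Kernel β F) [IsSFiniteKernel κ] [IsSFiniteKernel κ']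
    {h : E × F → ℝ≥0∞} (hh : Measurable h) :
    Measurable fun z : α × β => ∫⁻ x, ∫⁻ y, h (x, y) ∂(κ' z.2) ∂(κ z.1) := by
  have h1 : Measurable fun w : (α × β) × E => ∫⁻ y, h (w.2, y) ∂(κ' w.1.2) := by
    have := Measurable.lintegral_kernel_prod_right'
      (κ := κ'.comap (fun w : (α × β) × E => w.1.2) (measurable_snd.comp measurable_fst))
      (f := fun w => h (w.1.2, w.2)) (by fun_prop)
    simpa [Kernel.comap_apply] using this
  have := Measurable.lintegral_kernel_prod_right'
      (κ := κ.comap (fun w : α × β => w.1) measurable_fst) h1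
  simpa [Kernel.comap_apply] using this

end Kernel

/-- If two pairs of random measures, finite on the sets of a countable partition, have the same
joint Laplace functional, then double integrals with respect to them have the same Laplace
transform. -/
theorem integral_expNeg_lintegral_lintegral_eq {Ω Ω' E F : Type*} [MeasurableSpace Ω]
    [MeasurableSpace Ω'] [MeasurableSpace E] [MeasurableSpace F] {P : Measure Ω} {P' : Measure Ω'}
    [IsProbabilityMeasure P] [IsProbabilityMeasure P']
    {N : Ω → Measure E} {M : Ω → Measure F} {N' : Ω' → Measure E} {M' : Ω' → Measure F}
    (hN : Measurable N) (hM : Measurable M) (hN' : Measurable N') (hM' : Measurable M')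
    (hL : ∀ (f : E → ℝ≥0∞) (g : F → ℝ≥0∞), Measurable f → Measurable g →
      ∫ ω, expNeg (∫⁻ x, f x ∂(N ω) + ∫⁻ y, g y ∂(M ω)) ∂P
        = ∫ ω, expNeg (∫⁻ x, f x ∂(N' ω) + ∫⁻ y, g y ∂(M' ω)) ∂P')
    (m₁ : Measure E) (m₂ : Measure F) [SigmaFinite m₁] [SigmaFinite m₂]
    (hNfin : ∀ C, MeasurableSet C → m₁ C < ∞ → ∀ᵐ ω ∂P, N ω C < ∞)
    (hMfin : ∀ C, MeasurableSet C → m₂ C < ∞ → ∀ᵐ ω ∂P, M ω C < ∞)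
    (hNfin' : ∀ C, MeasurableSet C → m₁ C < ∞ → ∀ᵐ ω ∂P', N' ω C < ∞)
    (hMfin' : ∀ C, MeasurableSet C → m₂ C < ∞ → ∀ᵐ ω ∂P', M' ω C < ∞)
    {h : E × F → ℝ≥0∞} (hh : Measurable h) :
    ∫ ω, expNeg (∫⁻ x, ∫⁻ y, h (x, y) ∂(M ω) ∂(N ω)) ∂P
      = ∫ ω, expNeg (∫⁻ x, ∫⁻ y, h (x, y) ∂(M' ω) ∂(N' ω)) ∂P' := by
  let C := disjointed (spanningSets m₁)
  let D := disjointed (spanningSets m₂)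
  have hC : ∀ n, MeasurableSet (C n) :=
    fun n => MeasurableSet.disjointed (measurableSet_spanningSets m₁) n
  have hD : ∀ n, MeasurableSet (D n) :=
    fun n => MeasurableSet.disjointed (measurableSet_spanningSets m₂) n
  have hCfin : ∀ n, m₁ (C n) < ∞ := fun n =>
    (measure_mono (disjointed_subset _ _)).trans_lt (measure_spanningSets_lt_top m₁ n)
  have hDfin : ∀ n, m₂ (D n) < ∞ := fun n =>
    (measure_mono (disjointed_subset _ _)).trans_lt (measure_spanningSets_lt_top m₂ n)
  have hκ : ∀ μ : Measure E, (∀ n, μ (C n) < ∞) → partitionKernel hC μ = μ := fun μ hμ =>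
    partitionKernel_apply hC (disjoint_disjointed _)
      ((iUnion_disjointed).trans (iUnion_spanningSets m₁)) hμ
  have hκ' : ∀ μ : Measure F, (∀ n, μ (D n) < ∞) → partitionKernel hD μ = μ := fun μ hμ =>
    partitionKernel_apply hD (disjoint_disjointed _)
      ((iUnion_disjointed).trans (iUnion_spanningSets m₂)) hμ
  let Φ : Measure E × Measure F → ℝ := fun z =>
    expNeg (∫⁻ x, ∫⁻ y, h (x, y) ∂(partitionKernel hD z.2) ∂(partitionKernel hC z.1))
  have hΦ : Measurable Φ := measurable_expNeg.comp
    (Measurable.lintegral_lintegral_kernel (partitionKernel hC) (partitionKernel hD) hh)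
  have h1 : ∫ ω, expNeg (∫⁻ x, ∫⁻ y, h (x, y) ∂(M ω) ∂(N ω)) ∂P = ∫ ω, Φ (N ω, M ω) ∂P := by
    refine integral_congr_ae ?_
    filter_upwards [ae_all_iff.2 fun n => hNfin _ (hC n) (hCfin n),
      ae_all_iff.2 fun n => hMfin _ (hD n) (hDfin n)] with ω h1 h2
    simp only [Φ]
    rw [hκ _ h1, hκ' _ h2]
  have h2 : ∫ ω, expNeg (∫⁻ x, ∫⁻ y, h (x, y) ∂(M' ω) ∂(N' ω)) ∂P'
      = ∫ ω, Φ (N' ω, M' ω) ∂P' := by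
    refine integral_congr_ae ?_
    filter_upwards [ae_all_iff.2 fun n => hNfin' _ (hC n) (hCfin n),
      ae_all_iff.2 fun n => hMfin' _ (hD n) (hDfin n)] with ω h1 h2
    simp only [Φ]
    rw [hκ _ h1, hκ' _ h2]
  rw [h1, h2, ← integral_map (hN.prodMk hM).aemeasurable hΦ.aestronglyMeasurable,
    ← integral_map (hN'.prodMk hM').aemeasurable hΦ.aestronglyMeasurable,
    map_prodMk_eq_of_integral_expNeg hN hM hN' hM' hL]

/-! ### Inclusion and exclusion, and thinning -/

section Expansion

variable {Ω ι : Type*} [MeasurableSpace Ω] {P : Measure Ω} [IsProbabilityMeasure P]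

theorem integrable_prod_of_mem_Icc {a : ι → Ω → ℝ} (ha : ∀ k, Measurable (a k))
    (ha1 : ∀ k ω, a k ω ∈ Set.Icc (0 : ℝ) 1) (F : Finset ι) :
    Integrable (fun ω => ∏ k ∈ F, a k ω) P := by
  refine Integrable.of_bound (Finset.measurable_fun_prod F fun k _ => ha k).aestronglyMeasurable 1
    (Eventually.of_forall fun ω => ?_)
  rw [Real.norm_of_nonneg (Finset.prod_nonneg fun k _ => (ha1 k ω).1)]
  exact Finset.prod_le_one (fun k _ => (ha1 k ω).1) fun k _ => (ha1 k ω).2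

theorem integral_prod_one_sub_eq {a b : ι → Ω → ℝ} (ha : ∀ k, Measurable (a k))
    (hb : ∀ k, Measurable (b k)) (ha1 : ∀ k ω, a k ω ∈ Set.Icc (0 : ℝ) 1)
    (hb1 : ∀ k ω, b k ω ∈ Set.Icc (0 : ℝ) 1)
    (h : ∀ F : Finset ι, ∫ ω, ∏ k ∈ F, a k ω ∂P = ∫ ω, ∏ k ∈ F, b k ω ∂P) (K : Finset ι) :
    ∫ ω, ∏ k ∈ K, (1 - a k ω) ∂P = ∫ ω, ∏ k ∈ K, (1 - b k ω) ∂P := by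
  classical
  have hexp : ∀ c : ι → Ω → ℝ, (∀ k, Measurable (c k)) → (∀ k ω, c k ω ∈ Set.Icc (0 : ℝ) 1) →
      ∫ ω, ∏ k ∈ K, (1 - c k ω) ∂P
        = ∑ F ∈ K.powerset, (-1) ^ F.card * ∫ ω, ∏ k ∈ F, c k ω ∂P := by
    intro c hc hc1
    simp_rw [sub_eq_add_neg, Finset.prod_one_add, Finset.prod_neg]
    rw [integral_finsetSum _ fun F _ => (integrable_prod_of_mem_Icc hc hc1 F).const_mul _]
    simp_rw [integral_const_mul]
  rw [hexp a ha ha1, hexp b hb hb1]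
  exact Finset.sum_congr rfl fun F _ => by rw [h F]

/-- The Laplace transform of an infinite sum is determined by the mixed moments of the variables
`1 - expNeg (G k)`, by inclusion and exclusion. -/
theorem integral_expNeg_tsum_eq [Countable ι] {G G' : ι → Ω → ℝ≥0∞} (hG : ∀ k, Measurable (G k))
    (hG' : ∀ k, Measurable (G' k))
    (h : ∀ F : Finset ι, ∫ ω, ∏ k ∈ F, (1 - expNeg (G k ω)) ∂P
      = ∫ ω, ∏ k ∈ F, (1 - expNeg (G' k ω)) ∂P) :
    ∫ ω, expNeg (∑' k, G k ω) ∂P = ∫ ω, expNeg (∑' k, G' k ω) ∂P := by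
  obtain ⟨K, hK⟩ := exists_seq_tendsto (atTop : Filter (Finset ι))
  have hlim : ∀ c : ι → Ω → ℝ≥0∞, (∀ k, Measurable (c k)) →
      Tendsto (fun n => ∫ ω, ∏ k ∈ K n, (1 - (1 - expNeg (c k ω))) ∂P) atTop
        (𝓝 (∫ ω, expNeg (∑' k, c k ω) ∂P)) := by
    intro c hc
    have := tendsto_integral_expNeg (P := P) (F := fun n ω => ∑ k ∈ K n, c k ω)
      (f := fun ω => ∑' k, c k ω)
      (fun n => (Finset.measurable_fun_sum _ fun k _ => hc k).aemeasurable)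
      (Eventually.of_forall fun ω => (ENNReal.summable.hasSum (f := fun k => c k ω)).comp hK)
    simpa only [expNeg_sum, sub_sub_cancel] using this
  have hm : ∀ c : ι → Ω → ℝ≥0∞, (∀ k, Measurable (c k)) →
      ∀ k, Measurable fun ω => 1 - expNeg (c k ω) :=
    fun c hc k => measurable_const.sub (measurable_expNeg.comp (hc k))
  have h01 : ∀ c : ι → Ω → ℝ≥0∞, ∀ k ω, 1 - expNeg (c k ω) ∈ Set.Icc (0 : ℝ) 1 :=
    fun c k ω => ⟨sub_nonneg.2 (expNeg_le_one _), sub_le_self _ (expNeg_nonneg _)⟩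
  refine tendsto_nhds_unique (hlim G hG) ((hlim G' hG').congr fun n => ?_)
  exact (integral_prod_one_sub_eq (hm G hG) (hm G' hG') (h01 G) (h01 G') h (K n)).symm

end Expansion

theorem measurable_indicator_one {α : Type*} (i : α) :
    Measurable fun a : Set α => a.indicator (1 : α → ℝ) i := by
  classical
  exact Measurable.ite (measurableSet_mem i) measurable_const measurable_const

theorem indicator_one_mem_Icc {α : Type*} (s : Set α) (i : α) :
    s.indicator (1 : α → ℝ) i ∈ Set.Icc (0 : ℝ) 1 := by
  by_cases h : i ∈ s <;> simp [h]

theorem one_sub_expNeg_indicator {α : Type*} (s : Set α) (f : α → ℝ≥0∞) (i : α) :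
    1 - expNeg (s.indicator f i) = s.indicator (1 : α → ℝ) i * (1 - expNeg (f i)) := by
  by_cases h : i ∈ s <;> simp [h, expNeg_zero]

namespace IsSelection

variable {Ω 𝒟 : Type*} [MeasurableSpace Ω] [MeasurableSpace 𝒟] {P : Measure Ω}
  {p q : ℝ} {D : Ω → 𝒟} {A B : Ω → Set ℕ}

theorem measurable_fst (h : IsSelection P p q D A B) : Measurable A :=
  measurable_set_iff.2 fun i => measurableSet_setOfPred.1 (h.measurableSet_user i)

theorem measurable_snd (h : IsSelection P p q D A B) : Measurable B :=
  measurable_set_iff.2 fun i => measurableSet_setOfPred.1 (h.measurableSet_item i)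

theorem integral_mul_eq (h : IsSelection P p q D A B) (hD : Measurable D)
    {θ : Set ℕ × Set ℕ → ℝ} (hθ : Measurable θ) {ζ : 𝒟 → ℝ} (hζ : Measurable ζ) :
    ∫ ω, θ (A ω, B ω) * ζ (D ω) ∂P = (∫ ω, θ (A ω, B ω) ∂P) * ∫ ω, ζ (D ω) ∂P :=
  (h.indep_data.comp hθ hζ).integral_fun_mul_eq_mul_integral
    (hθ.comp (h.measurable_fst.prodMk h.measurable_snd)).aestronglyMeasurable
    (hζ.comp hD).aestronglyMeasurable

/-- The indicator that a user `inl i` or an item `inr j` is selected. -/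
noncomputable def weight (k : ℕ ⊕ ℕ) (c : Set ℕ × Set ℕ) : ℝ :=
  Sum.elim (fun i => c.1.indicator (1 : ℕ → ℝ) i) (fun j => c.2.indicator (1 : ℕ → ℝ) j) k

theorem measurable_weight (k : ℕ ⊕ ℕ) : Measurable (weight k) := by
  rcases k with i | j
  · exact (measurable_indicator_one i).comp _root_.measurable_fst
  · exact (measurable_indicator_one j).comp _root_.measurable_snd

theorem integral_prod_weight [IsProbabilityMeasure P] (h : IsSelection P p q D A B) (hp : 0 ≤ p)
    (hq : 0 ≤ q) (F : Finset (ℕ ⊕ ℕ)) : ∫ ω, ∏ k ∈ F, weight k (A ω, B ω) ∂P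
      = ∏ k ∈ F, Sum.elim (fun _ : ℕ => p) (fun _ : ℕ => q) k := by
  set S : ℕ ⊕ ℕ → Set Ω := Sum.elim (fun i : ℕ => {ω | i ∈ A ω}) (fun j : ℕ => {ω | j ∈ B ω})
    with hS
  have hSm : ∀ k, MeasurableSet (S k) := by
    rintro (i | j)
    · exact h.measurableSet_user i
    · exact h.measurableSet_item j
  have hw : ∀ ω, ∏ k ∈ F, weight k (A ω, B ω) = (⋂ k ∈ F, S k).indicator 1 ω := by
    intro ω
    have hk : ∀ k, weight k (A ω, B ω) = (S k).indicator 1 ω := by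
      classical
      rintro (i | j) <;> simp [weight, S, Set.indicator_apply]
    classical
    simp_rw [hk, Set.indicator_apply, Pi.one_apply, Finset.prod_ite_zero, Finset.prod_const_one,
      Set.mem_iInter]
  simp_rw [hw]
  rw [integral_indicator_one (Finset.measurableSet_biInter F fun k _ => hSm k), measureReal_def,
    h.indep.meas_biInter F, ENNReal.toReal_prod]
  refine Finset.prod_congr rfl fun k _ => ?_
  rcases k with i | j
  · simp [h.prob_user, hp]
  · simp [h.prob_item, hq]

/-- Thinning at the level of Laplace transforms: averaging over the selections replaces each factor
`exp (-u)` by `1 - p (1 - exp (-u))`. The terms may depend on the data `D` in any way. -/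
theorem integral_expNeg_thinning [IsProbabilityMeasure P] (h : IsSelection P p q D A B)
    (hD : Measurable D) (hp : p ∈ Set.Icc (0 : ℝ) 1) (hq : q ∈ Set.Icc (0 : ℝ) 1)
    {u v : ℕ → 𝒟 → ℝ≥0∞} (hu : ∀ i, Measurable (u i)) (hv : ∀ j, Measurable (v j)) :
    ∫ ω, expNeg (∑' i, (A ω).indicator (fun i => u i (D ω)) i
        + ∑' j, (B ω).indicator (fun j => v j (D ω)) j) ∂P
      = ∫ ω, expNeg (∑' i, negLog (1 - p * (1 - expNeg (u i (D ω))))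
        + ∑' j, negLog (1 - q * (1 - expNeg (v j (D ω))))) ∂P := by
  classical
  let z : ℕ ⊕ ℕ → 𝒟 → ℝ := Sum.elim (fun i d => 1 - expNeg (u i d)) (fun j d => 1 - expNeg (v j d))
  have hz : ∀ k, Measurable (z k) := by
    rintro (i | j)
    · exact measurable_const.sub (measurable_expNeg.comp (hu i))
    · exact measurable_const.sub (measurable_expNeg.comp (hv j))
  have hind : ∀ (C : Ω → Set ℕ) (w : ℕ → 𝒟 → ℝ≥0∞), Measurable C → (∀ i, Measurable (w i)) →
      ∀ i, Measurable fun ω => (C ω).indicator (fun i => w i (D ω)) i := by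
    intro C w hC hw i
    simp_rw [Set.indicator_apply]
    exact Measurable.ite (hC (measurableSet_mem i)) ((hw i).comp hD) measurable_const
  have hneg : ∀ (r : ℝ) (w : 𝒟 → ℝ≥0∞), Measurable w →
      Measurable fun ω => negLog (1 - r * (1 - expNeg (w (D ω)))) := fun r w hw =>
    measurable_negLog.comp (measurable_const.sub
      (measurable_const.mul (measurable_const.sub (measurable_expNeg.comp (hw.comp hD)))))
  have hval : ∀ r ∈ Set.Icc (0 : ℝ) 1, ∀ x : ℝ≥0∞,
      1 - expNeg (negLog (1 - r * (1 - expNeg x))) = r * (1 - expNeg x) := by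
    intro r hr x
    have h0 := expNeg_nonneg x
    have h1 := expNeg_le_one x
    rw [expNeg_negLog (by nlinarith [hr.1, hr.2]) (by nlinarith [hr.1, hr.2])]
    ring
  have key := integral_expNeg_tsum_eq (P := P)
    (G := Sum.elim (fun i ω => (A ω).indicator (fun i => u i (D ω)) i)
      (fun j ω => (B ω).indicator (fun j => v j (D ω)) j))
    (G' := Sum.elim (fun i ω => negLog (1 - p * (1 - expNeg (u i (D ω)))))
      (fun j ω => negLog (1 - q * (1 - expNeg (v j (D ω))))))
    (by
      rintro (i | j)
      · exact hind A u h.measurable_fst hu i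
      · exact hind B v h.measurable_snd hv j)
    (by
      rintro (i | j)
      · exact hneg p _ (hu i)
      · exact hneg q _ (hv j))
    (fun F => by
      have e1 : ∀ ω, ∏ k ∈ F, (1 - expNeg (Sum.elim
          (fun i ω => (A ω).indicator (fun i => u i (D ω)) i)
          (fun j ω => (B ω).indicator (fun j => v j (D ω)) j) k ω))
          = (∏ k ∈ F, weight k (A ω, B ω)) * ∏ k ∈ F, z k (D ω) := by
        intro ω
        rw [← Finset.prod_mul_distrib]
        refine Finset.prod_congr rfl fun k _ => ?_
        rcases k with i | j
        · exact one_sub_expNeg_indicator (A ω) (fun i => u i (D ω)) i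
        · exact one_sub_expNeg_indicator (B ω) (fun j => v j (D ω)) j
      have e2 : ∀ ω, ∏ k ∈ F, (1 - expNeg (Sum.elim
          (fun i ω => negLog (1 - p * (1 - expNeg (u i (D ω)))))
          (fun j ω => negLog (1 - q * (1 - expNeg (v j (D ω))))) k ω))
          = (∏ k ∈ F, Sum.elim (fun _ : ℕ => p) (fun _ : ℕ => q) k) * ∏ k ∈ F, z k (D ω) := by
        intro ω
        rw [← Finset.prod_mul_distrib]
        refine Finset.prod_congr rfl fun k _ => ?_
        rcases k with i | j
        · exact hval p hp _
        · exact hval q hq _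
      simp_rw [e1, e2]
      rw [integral_const_mul, ← h.integral_prod_weight hp.1 hq.1]
      exact h.integral_mul_eq hD (θ := fun c => ∏ k ∈ F, weight k c)
        (Finset.measurable_fun_prod F fun k _ => measurable_weight k)
        (ζ := fun d => ∏ k ∈ F, z k d) (Finset.measurable_fun_prod F fun k _ => hz k))
  simpa only [ENNReal.summable.tsum_sum ENNReal.summable, Sum.elim_inl, Sum.elim_inr] using key

end IsSelection

/-! ### Thinned and rescaled Poisson processes -/

section SelectedProcess

variable {Ω E : Type*} [MeasurableSpace E]

/-- The point process of the points `x i ω` with selected index `i ∈ A ω`. -/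
noncomputable def selectedProcess (x : ℕ → Ω → E) (A : Ω → Set ℕ) (ω : Ω) : Measure E :=
  Measure.sum ((A ω).indicator fun i => Measure.dirac (x i ω))

theorem selectedProcess_apply (x : ℕ → Ω → E) (A : Ω → Set ℕ) (ω : Ω) {C : Set E}
    (hC : MeasurableSet C) : selectedProcess x A ω C
      = ∑' i, (A ω).indicator (fun i => C.indicator (1 : E → ℝ≥0∞) (x i ω)) i := by
  rw [selectedProcess, Measure.sum_apply _ hC]
  refine tsum_congr fun i => ?_
  by_cases h : i ∈ A ω
  · rw [Set.indicator_of_mem h, Set.indicator_of_mem h, Measure.dirac_apply' _ hC]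
  · rw [Set.indicator_of_notMem h, Set.indicator_of_notMem h, Measure.coe_zero, Pi.zero_apply]

theorem measurable_selectedProcess [MeasurableSpace Ω] {x : ℕ → Ω → E} (hx : ∀ i, Measurable (x i))
    {A : Ω → Set ℕ} (hA : Measurable A) : Measurable (selectedProcess x A) := by
  classical
  refine Measure.measurable_of_measurable_coe _ fun C hC => ?_
  simp_rw [selectedProcess_apply x A _ hC]
  refine Measurable.tsum fun i => ?_
  simp_rw [Set.indicator_apply (s := A _)]
  exact Measurable.ite (hA (measurableSet_mem i)) ((measurable_one.indicator hC).comp (hx i))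
    measurable_const

theorem lintegral_selectedProcess (x : ℕ → Ω → E) (A : Ω → Set ℕ) (ω : Ω) {f : E → ℝ≥0∞}
    (hf : Measurable f) :
    ∫⁻ e, f e ∂(selectedProcess x A ω) = ∑' i, (A ω).indicator (fun i => f (x i ω)) i := by
  rw [selectedProcess, lintegral_sum_measure]
  refine tsum_congr fun i => ?_
  by_cases h : i ∈ A ω
  · rw [Set.indicator_of_mem h, Set.indicator_of_mem h, lintegral_dirac' _ hf]
  · rw [Set.indicator_of_notMem h, Set.indicator_of_notMem h, lintegral_zero_measure]

theorem lintegral_pointProcess (x : ℕ → Ω → E) (ω : Ω) {f : E → ℝ≥0∞}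
    (hf : Measurable f) : ∫⁻ e, f e ∂(pointProcess x ω) = ∑' i, f (x i ω) := by
  rw [pointProcess, lintegral_sum_measure]
  exact tsum_congr fun i => lintegral_dirac' _ hf

theorem pointProcess_apply (x : ℕ → Ω → E) (ω : Ω) {C : Set E}
    (hC : MeasurableSet C) : pointProcess x ω C
      = ∑' i, C.indicator (1 : E → ℝ≥0∞) (x i ω) := by
  rw [← lintegral_indicator_one hC, lintegral_pointProcess _ _ (measurable_one.indicator hC)]

theorem selectedProcess_comp_le (x : ℕ → Ω → E) (A : Ω → Set ℕ) {r : E → E} (hr : Measurable r)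
    (ω : Ω) {C : Set E} (hC : MeasurableSet C) :
    selectedProcess (fun i ω => r (x i ω)) A ω C ≤ pointProcess x ω (r ⁻¹' C) := by
  rw [selectedProcess_apply _ _ _ hC, pointProcess_apply _ _ (hr hC)]
  exact ENNReal.tsum_le_tsum fun i => Set.indicator_le_self (A ω) _ i

end SelectedProcess

/-- The mean measure of the Poisson process of the vertices of one kind, with features in `X` and
labels in `[0, ∞)`. -/
noncomputable abbrev labelIntensity {X : Type*} [MeasurableSpace X] (η : Measure X) :
    Measure (X × ℝ) :=
  η.prod ((volume : Measure ℝ).restrict (Set.Ici 0))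

/-- Multiplication of the label of a vertex by `p`. -/
def scaleLabel {X : Type*} (p : ℝ) (x : X × ℝ) : X × ℝ := (x.1, p * x.2)

theorem measurable_scaleLabel {X : Type*} [MeasurableSpace X] (p : ℝ) :
    Measurable (scaleLabel p : X × ℝ → X × ℝ) := by
  unfold scaleLabel; fun_prop

theorem map_scaleLabel {X : Type*} [MeasurableSpace X] (η : Measure X) [SigmaFinite η] {p : ℝ}
    (hp : 0 < p) :
    (labelIntensity η).map (scaleLabel p) = ENNReal.ofReal p⁻¹ • labelIntensity η := by
  have h1 : ((volume : Measure ℝ).restrict (Set.Ici 0)).map (p * ·)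
      = ENNReal.ofReal p⁻¹ • (volume : Measure ℝ).restrict (Set.Ici 0) := by
    have hpre : (p * ·) ⁻¹' Set.Ici (0 : ℝ) = Set.Ici 0 := by
      ext u
      simp [mul_nonneg_iff_of_pos_left hp]
    conv_lhs => rw [← hpre]
    rw [← Measure.restrict_map (measurable_const_mul p) measurableSet_Ici,
      Real.map_volume_mul_left hp.ne', abs_of_pos (inv_pos.2 hp), Measure.restrict_smul]
  have h2 : (scaleLabel p : X × ℝ → X × ℝ) = Prod.map id (p * ·) := rfl
  rw [h2, labelIntensity, ← Measure.map_prod_map _ _ measurable_id (measurable_const_mul p), h1,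
    Measure.map_id, Measure.prod_smul_right]

theorem labelIntensity_preimage_scaleLabel_lt_top {X : Type*} [MeasurableSpace X] (η : Measure X)
    [SigmaFinite η] {p : ℝ} (hp : 0 < p) {C : Set (X × ℝ)} (hC : MeasurableSet C)
    (h : labelIntensity η C < ∞) : labelIntensity η (scaleLabel p ⁻¹' C) < ∞ := by
  rw [← Measure.map_apply (measurable_scaleLabel p) hC, map_scaleLabel η hp]
  exact ENNReal.mul_lt_top ENNReal.ofReal_lt_top h

theorem measurable_thinned {X : Type*} [MeasurableSpace X] (p : ℝ) {f : X × ℝ → ℝ≥0∞}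
    (hf : Measurable f) :
    Measurable fun x => negLog (1 - p * (1 - expNeg (f (scaleLabel p x)))) :=
  measurable_negLog.comp (measurable_const.sub (measurable_const.mul
    (measurable_const.sub (measurable_expNeg.comp (hf.comp (measurable_scaleLabel p))))))

/-- Independent thinning with retention probability `p`, followed by multiplication of the labels
by `p`, leaves the Laplace functional of the Poisson process unchanged. -/
theorem integral_expNeg_thinned_poisson {Ω X : Type*} [MeasurableSpace Ω] [MeasurableSpace X]
    {P : Measure Ω} [IsProbabilityMeasure P] {η : Measure X} [SigmaFinite η]
    {N : Ω → Measure (X × ℝ)} (hN : IsPoissonProcess N (labelIntensity η) P) {p : ℝ}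
    (hp : p ∈ Set.Ioc (0 : ℝ) 1) {f : X × ℝ → ℝ≥0∞} (hf : Measurable f) :
    ∫ ω, expNeg (∫⁻ x, negLog (1 - p * (1 - expNeg (f (scaleLabel p x)))) ∂(N ω)) ∂P
      = expNeg (∫⁻ x, ENNReal.ofReal (1 - expNeg (f x)) ∂(labelIntensity η)) := by
  have hg : Measurable fun x => ENNReal.ofReal (1 - expNeg (f x)) :=
    (measurable_const.sub (measurable_expNeg.comp hf)).ennreal_ofReal
  have hr : Measurable (scaleLabel p : X × ℝ → X × ℝ) := measurable_scaleLabel p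
  rw [hN.integral_expNeg_lintegral (measurable_thinned p hf)]
  congr 1
  have hval : ∀ x : X × ℝ, ENNReal.ofReal
      (1 - expNeg (negLog (1 - p * (1 - expNeg (f (scaleLabel p x))))))
      = ENNReal.ofReal p * ENNReal.ofReal (1 - expNeg (f (scaleLabel p x))) := by
    intro x
    have h0 := expNeg_nonneg (f (scaleLabel p x))
    have h1 := expNeg_le_one (f (scaleLabel p x))
    rw [expNeg_negLog (by nlinarith [hp.1, hp.2]) (by nlinarith [hp.1, hp.2]),
      ← ENNReal.ofReal_mul hp.1.le]
    congr 1
    ring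
  simp_rw [hval]
  rw [lintegral_const_mul' _ _ ENNReal.ofReal_ne_top, ← lintegral_map hg hr, map_scaleLabel η hp.1,
    lintegral_smul_measure, smul_eq_mul, ← mul_assoc, ← ENNReal.ofReal_mul hp.1.le,
    mul_inv_cancel₀ hp.1.ne', ENNReal.ofReal_one, one_mul]

namespace IsExchangeableGraphModel

variable {Ω 𝒳 𝒴 : Type*} [MeasurableSpace Ω] [MeasurableSpace 𝒳]
  [MeasurableSpace 𝒴] {P : Measure Ω} {η : Measure 𝒳} {ν : Measure 𝒴} {W : 𝒳 → 𝒴 → ℝ}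
  {user : ℕ → Ω → 𝒳 × ℝ} {item : ℕ → Ω → 𝒴 × ℝ} {edge : Ω → Set (ℕ × ℕ)}
  {p q : ℝ} {A B : Ω → Set ℕ}

theorem measurable_data (hG : IsExchangeableGraphModel P η ν W user item edge) :
    Measurable fun ω => ((fun i => user i ω), (fun j => item j ω), edge ω) := by
  refine (measurable_pi_lambda _ hG.measurable_user).prodMk
    ((measurable_pi_lambda _ hG.measurable_item).prodMk (measurable_set_iff.2 fun k => ?_))
  exact measurableSet_setOfPred.1 (hG.measurableSet_edge k.1 k.2)

/-- The joint Laplace functional of the selected users and items, with rescaled labels, does not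
depend on the selection probabilities. -/
theorem integral_expNeg_selectedProcess [IsProbabilityMeasure P] [SigmaFinite η] [SigmaFinite ν]
    (hG : IsExchangeableGraphModel P η ν W user item edge)
    (hp : p ∈ Set.Ioc (0 : ℝ) 1) (hq : q ∈ Set.Ioc (0 : ℝ) 1)
    (hAB : IsSelection P p q (fun ω => ((fun i => user i ω), (fun j => item j ω), edge ω)) A B)
    {f : 𝒳 × ℝ → ℝ≥0∞} {g : 𝒴 × ℝ → ℝ≥0∞} (hf : Measurable f) (hg : Measurable g) :
    ∫ ω, expNeg (∫⁻ x, f x ∂(selectedProcess (fun i ω => scaleLabel p (user i ω)) A ω)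
        + ∫⁻ y, g y ∂(selectedProcess (fun j ω => scaleLabel q (item j ω)) B ω)) ∂P
      = expNeg (∫⁻ x, ENNReal.ofReal (1 - expNeg (f x)) ∂(labelIntensity η))
        * expNeg (∫⁻ y, ENNReal.ofReal (1 - expNeg (g y)) ∂(labelIntensity ν)) := by
  have hthin := measurable_thinned p hf
  have hthin' := measurable_thinned q hg
  simp_rw [lintegral_selectedProcess _ _ _ hf, lintegral_selectedProcess _ _ _ hg]
  have key := hAB.integral_expNeg_thinning hG.measurable_data ⟨hp.1.le, hp.2⟩ ⟨hq.1.le, hq.2⟩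
    (u := fun i d => f (scaleLabel p (d.1 i))) (v := fun j d => g (scaleLabel q (d.2.1 j)))
    (fun i => (hf.comp (measurable_scaleLabel p)).comp
      ((measurable_pi_apply i).comp measurable_fst))
    (fun j => (hg.comp (measurable_scaleLabel q)).comp
      ((measurable_pi_apply j).comp (measurable_fst.comp measurable_snd)))
  rw [key, ← integral_expNeg_thinned_poisson hG.poisson_user hp hf,
    ← integral_expNeg_thinned_poisson hG.poisson_item hq hg]
  simp_rw [lintegral_pointProcess _ _ hthin, lintegral_pointProcess _ _ hthin',
    expNeg_add]
  have hind := hG.indep_user_item.comp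
    (measurable_expNeg.comp (Measure.measurable_lintegral hthin))
    (measurable_expNeg.comp (Measure.measurable_lintegral hthin'))
  have := hind.integral_fun_mul_eq_mul_integral
    ((measurable_expNeg.comp (Measure.measurable_lintegral hthin)).comp
      hG.poisson_user.measurable).aestronglyMeasurable
    ((measurable_expNeg.comp (Measure.measurable_lintegral hthin')).comp
      hG.poisson_item.measurable).aestronglyMeasurable
  simpa only [Function.comp_apply, lintegral_pointProcess _ _ hthin,
    lintegral_pointProcess _ _ hthin'] using this

end IsExchangeableGraphModel

/-! ### The conditional probability that there is no edge in a set -/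

/-- The function `-log (1 - W 1_T)`: its double integral with respect to the point processes of
users and items is `-log` of the conditional probability that no edge has its end points in `T`. -/
noncomputable def edgeRate {X Y : Type*} (W : X → Y → ℝ) (T : Set ((X × ℝ) × (Y × ℝ)))
    (z : (X × ℝ) × (Y × ℝ)) : ℝ≥0∞ :=
  negLog (1 - W z.1.1 z.2.1 * T.indicator 1 z)

theorem measurable_edgeRate {X Y : Type*} [MeasurableSpace X] [MeasurableSpace Y] {W : X → Y → ℝ}
    (hW : Measurable (Function.uncurry W)) {T : Set ((X × ℝ) × (Y × ℝ))} (hT : MeasurableSet T) :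
    Measurable (edgeRate W T) := by
  have h1 : Measurable fun z : (X × ℝ) × (Y × ℝ) => W z.1.1 z.2.1 :=
    hW.comp ((measurable_fst.comp measurable_fst).prodMk (measurable_fst.comp measurable_snd))
  exact measurable_negLog.comp (measurable_const.sub (h1.mul (measurable_one.indicator hT)))

theorem one_sub_expNeg_edgeRate {X Y : Type*} {W : X → Y → ℝ}
    (hW01 : ∀ x y, W x y ∈ Set.Icc (0 : ℝ) 1) (T : Set ((X × ℝ) × (Y × ℝ)))
    (z : (X × ℝ) × (Y × ℝ)) :
    1 - expNeg (edgeRate W T z) = W z.1.1 z.2.1 * T.indicator 1 z := by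
  have h1 := hW01 z.1.1 z.2.1
  by_cases hz : z ∈ T
  · simp only [edgeRate, Set.indicator_of_mem hz, Pi.one_apply, mul_one]
    rw [expNeg_negLog (by linarith [h1.2]) (by linarith [h1.1])]
    ring
  · simp only [edgeRate, Set.indicator_of_notMem hz, mul_zero, sub_zero]
    rw [expNeg_negLog zero_le_one le_rfl]
    ring

theorem measurable_pair_pointSigma {Ω E F : Type*} [MeasurableSpace E] [MeasurableSpace F]
    (user : ℕ → Ω → E) (item : ℕ → Ω → F) (k : ℕ × ℕ) :
    Measurable[pointSigma user item] fun ω => (user k.1 ω, item k.2 ω) := by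
  refine Measurable.prodMk ?_ ?_
  · exact Measurable.mono (comap_measurable (user k.1))
      ((le_iSup (fun i => MeasurableSpace.comap (user i) inferInstance) k.1).trans le_sup_left)
      le_rfl
  · exact Measurable.mono (comap_measurable (item k.2))
      ((le_iSup (fun i => MeasurableSpace.comap (item i) inferInstance) k.2).trans le_sup_right)
      le_rfl

namespace IsExchangeableGraphModel

variable {Ω 𝒳 𝒴 : Type*} [MeasurableSpace Ω] [MeasurableSpace 𝒳]
  [MeasurableSpace 𝒴] {P : Measure Ω} {η : Measure 𝒳} {ν : Measure 𝒴} {W : 𝒳 → 𝒴 → ℝ}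
  {user : ℕ → Ω → 𝒳 × ℝ} {item : ℕ → Ω → 𝒴 × ℝ} {edge : Ω → Set (ℕ × ℕ)}
  {p q : ℝ} {A B : Ω → Set ℕ}

theorem pointSigma_le (hG : IsExchangeableGraphModel P η ν W user item edge) :
    pointSigma user item ≤ ‹MeasurableSpace Ω› :=
  sup_le (iSup_le fun i => (hG.measurable_user i).comap_le)
    (iSup_le fun j => (hG.measurable_item j).comap_le)

/-- Given the users and the items, the edge indicators may be replaced by their conditional
probabilities. -/
theorem integral_prod_edge [IsProbabilityMeasure P]
    (hG : IsExchangeableGraphModel P η ν W user item edge)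
    {T : Set ((𝒳 × ℝ) × (𝒴 × ℝ))} (hT : MeasurableSet T) (F : Finset (ℕ × ℕ)) :
    ∫ ω, ∏ k ∈ F, ((edge ω).indicator 1 k * T.indicator 1 (user k.1 ω, item k.2 ω)) ∂P
      = ∫ ω, ∏ k ∈ F, (W (user k.1 ω).1 (item k.2 ω).1
          * T.indicator 1 (user k.1 ω, item k.2 ω)) ∂P := by
  classical
  let τ : Ω → ℝ := fun ω => ∏ k ∈ F, T.indicator 1 (user k.1 ω, item k.2 ω)
  let S : Set Ω := {ω | ∀ x ∈ F, x ∈ edge ω}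
  have hSm : MeasurableSet S := by
    have : S = ⋂ x ∈ F, {ω | (x.1, x.2) ∈ edge ω} := by ext ω; simp [S]
    rw [this]
    exact Finset.measurableSet_biInter F fun x _ => hG.measurableSet_edge x.1 x.2
  have hτm : Measurable[pointSigma user item] τ :=
    Finset.measurable_fun_prod F fun k _ =>
      (measurable_one.indicator hT).comp (measurable_pair_pointSigma user item k)
  have hτ01 : ∀ ω, ‖τ ω‖ ≤ 1 := by
    intro ω
    rw [Real.norm_of_nonneg (Finset.prod_nonneg fun k _ => (indicator_one_mem_Icc T _).1)]
    exact Finset.prod_le_one (fun k _ => (indicator_one_mem_Icc T _).1)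
      fun k _ => (indicator_one_mem_Icc T _).2
  have hSint : Integrable (S.indicator fun _ => (1 : ℝ)) P :=
    (integrable_const 1).indicator hSm
  have hSτ : Integrable ((S.indicator fun _ => (1 : ℝ)) * τ) P :=
    hSint.mul_bdd (hτm.mono hG.pointSigma_le le_rfl).aestronglyMeasurable
      (Eventually.of_forall hτ01)
  have e1 : ∀ ω, ∏ k ∈ F, ((edge ω).indicator 1 k * T.indicator 1 (user k.1 ω, item k.2 ω))
      = ((S.indicator fun _ => (1 : ℝ)) * τ) ω := by
    intro ω
    rw [Finset.prod_mul_distrib, Pi.mul_apply]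
    congr 1
    simp only [Set.indicator_apply, Pi.one_apply, Finset.prod_ite_zero, Finset.prod_const_one]
    rfl
  have hpull := condExp_mul_of_stronglyMeasurable_right (μ := P) hτm.stronglyMeasurable hSτ hSint
  simp_rw [e1]
  rw [← integral_condExp hG.pointSigma_le]
  refine integral_congr_ae ?_
  filter_upwards [hpull, hG.bernoulli_edge F] with ω h1 h2
  rw [h1, Pi.mul_apply, Finset.prod_mul_distrib]
  rw [h2]

/-- The probability that no edge between selected vertices has its end points in `T`. -/
theorem measureReal_no_edge [IsProbabilityMeasure P]
    (hG : IsExchangeableGraphModel P η ν W user item edge)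
    (hW : Measurable (Function.uncurry W)) (hW01 : ∀ x y, W x y ∈ Set.Icc (0 : ℝ) 1)
    (hAB : IsSelection P p q (fun ω => ((fun i => user i ω), (fun j => item j ω), edge ω)) A B)
    {T : Set ((𝒳 × ℝ) × (𝒴 × ℝ))} (hT : MeasurableSet T) :
    P.real {ω | ∀ k ∈ edge ω, k.1 ∈ A ω → k.2 ∈ B ω → (user k.1 ω, item k.2 ω) ∉ T}
      = ∫ ω, expNeg (∑' i, (A ω).indicator (fun i => ∑' j, (B ω).indicator
          (fun j => edgeRate W T (user i ω, item j ω)) j) i) ∂P := by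
  classical
  -- `expNeg` of the sum of the variables `G k` is the indicator of the event.
  let G : ℕ × ℕ → Ω → ℝ≥0∞ := fun k ω => (A ω ×ˢ B ω).indicator (fun k =>
    (edge ω).indicator (fun k => T.indicator (fun _ => ∞) (user k.1 ω, item k.2 ω)) k) k
  let G' : ℕ × ℕ → Ω → ℝ≥0∞ := fun k ω => (A ω ×ˢ B ω).indicator (fun k =>
    edgeRate W T (user k.1 ω, item k.2 ω)) k
  have huser : ∀ k : ℕ × ℕ, Measurable fun ω => (user k.1 ω, item k.2 ω) :=
    fun k => (hG.measurable_user k.1).prodMk (hG.measurable_item k.2)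
  have hsel : ∀ k : ℕ × ℕ, MeasurableSet {ω | k ∈ A ω ×ˢ B ω} := fun k =>
    (hAB.measurableSet_user k.1).inter (hAB.measurableSet_item k.2)
  have hedge : ∀ k : ℕ × ℕ, MeasurableSet {ω | k ∈ edge ω} := fun k =>
    hG.measurableSet_edge k.1 k.2
  have hGm : ∀ k, Measurable (G k) := fun k => by
    simp only [G, Set.indicator_apply]
    refine Measurable.ite (hsel k) (Measurable.ite (hedge k) (Measurable.ite ?_
      measurable_const measurable_const) measurable_const) measurable_const
    exact huser k hT
  have hGm' : ∀ k, Measurable (G' k) := fun k => by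
    simp only [G', Set.indicator_apply]
    exact Measurable.ite (hsel k) ((measurable_edgeRate hW hT).comp (huser k)) measurable_const
  have key := integral_expNeg_tsum_eq (P := P) hGm hGm' (fun F => by
    have hone : ∀ s : Set ((𝒳 × ℝ) × (𝒴 × ℝ)), ∀ z,
        1 - expNeg (s.indicator (fun _ => ∞) z) = s.indicator 1 z := fun s z => by
      rw [one_sub_expNeg_indicator, expNeg_top, sub_zero, mul_one]
    have e1 : ∀ ω, ∏ k ∈ F, (1 - expNeg (G k ω))
        = (∏ k ∈ F, (A ω ×ˢ B ω).indicator 1 k) * ∏ k ∈ F, ((edge ω).indicator 1 k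
          * T.indicator 1 (user k.1 ω, item k.2 ω)) := by
      intro ω
      rw [← Finset.prod_mul_distrib]
      refine Finset.prod_congr rfl fun k _ => ?_
      simp only [G]
      rw [one_sub_expNeg_indicator, one_sub_expNeg_indicator, hone]
    have e2 : ∀ ω, ∏ k ∈ F, (1 - expNeg (G' k ω))
        = (∏ k ∈ F, (A ω ×ˢ B ω).indicator 1 k) * ∏ k ∈ F, (W (user k.1 ω).1 (item k.2 ω).1
          * T.indicator 1 (user k.1 ω, item k.2 ω)) := by
      intro ω
      rw [← Finset.prod_mul_distrib]
      refine Finset.prod_congr rfl fun k _ => ?_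
      simp only [G']
      rw [one_sub_expNeg_indicator, one_sub_expNeg_edgeRate hW01]
    simp_rw [e1, e2]
    have hθ : Measurable fun c : Set ℕ × Set ℕ =>
        ∏ k ∈ F, (c.1 ×ˢ c.2).indicator (1 : ℕ × ℕ → ℝ) k := by
      refine Finset.measurable_fun_prod F fun k _ => ?_
      simp only [Set.indicator_apply]
      exact Measurable.ite ((measurable_fst (measurableSet_mem k.1)).inter
        (measurable_snd (measurableSet_mem k.2))) measurable_const measurable_const
    have hz : ∀ k : ℕ × ℕ, Measurable
        fun d : (ℕ → 𝒳 × ℝ) × (ℕ → 𝒴 × ℝ) × Set (ℕ × ℕ) => (d.1 k.1, d.2.1 k.2) := fun k => by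
      fun_prop
    have h1 := hAB.integral_mul_eq hG.measurable_data hθ
      (ζ := fun d => ∏ k ∈ F, ((d.2.2).indicator 1 k * T.indicator 1 (d.1 k.1, d.2.1 k.2)))
      (Finset.measurable_fun_prod F fun k _ => ((measurable_indicator_one k).comp
        (measurable_snd.comp measurable_snd)).mul ((measurable_one.indicator hT).comp (hz k)))
    have h2 := hAB.integral_mul_eq hG.measurable_data hθ
      (ζ := fun d => ∏ k ∈ F, (W (d.1 k.1).1 (d.2.1 k.2).1 * T.indicator 1 (d.1 k.1, d.2.1 k.2)))
      (Finset.measurable_fun_prod F fun k _ => (hW.comp (((measurable_fst.comp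
        measurable_fst).prodMk (measurable_fst.comp measurable_snd)).comp (hz k))).mul
          ((measurable_one.indicator hT).comp (hz k)))
    simp only at h1 h2
    rw [h1, h2, hG.integral_prod_edge hT F])
  have hleft : ∀ ω, expNeg (∑' k, G k ω) = {ω | ∀ k ∈ edge ω, k.1 ∈ A ω → k.2 ∈ B ω →
      (user k.1 ω, item k.2 ω) ∉ T}.indicator 1 ω := by
    intro ω
    have hmem : ∀ k, k ∈ A ω ×ˢ B ω ∧ k ∈ edge ω ∧ (user k.1 ω, item k.2 ω) ∈ T →
        G k ω = ∞ := by
      rintro k ⟨h1, h2, h3⟩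
      simp only [G]
      rw [Set.indicator_of_mem h1, Set.indicator_of_mem h2, Set.indicator_of_mem h3]
    have hnot : ∀ k, ¬ (k ∈ A ω ×ˢ B ω ∧ k ∈ edge ω ∧ (user k.1 ω, item k.2 ω) ∈ T) →
        G k ω = 0 := by
      intro k hk
      simp only [G, Set.indicator_apply]
      split_ifs <;> tauto
    by_cases hω : ω ∈ {ω | ∀ k ∈ edge ω, k.1 ∈ A ω → k.2 ∈ B ω → (user k.1 ω, item k.2 ω) ∉ T}
    · rw [Set.indicator_of_mem hω, Pi.one_apply, ENNReal.tsum_eq_zero.2, expNeg_zero]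
      exact fun k => hnot k fun h => hω k h.2.1 h.1.1 h.1.2 h.2.2
    · rw [Set.indicator_of_notMem hω]
      simp only [Set.mem_ofPred_eq, not_forall, not_not] at hω
      obtain ⟨k, h1, h2, h3, h4⟩ := hω
      rw [ENNReal.tsum_eq_top_of_eq_top ⟨k, hmem k ⟨⟨h2, h3⟩, h1, h4⟩⟩, expNeg_top]
  have hright : ∀ ω, ∑' k, G' k ω = ∑' i, (A ω).indicator (fun i => ∑' j, (B ω).indicator
      (fun j => edgeRate W T (user i ω, item j ω)) j) i := by
    intro ω
    rw [ENNReal.tsum_prod']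
    refine tsum_congr fun i => ?_
    by_cases hi : i ∈ A ω
    · rw [Set.indicator_of_mem hi]
      refine tsum_congr fun j => ?_
      simp [G', Set.indicator_apply, hi]
    · rw [Set.indicator_of_notMem hi, ENNReal.tsum_eq_zero]
      intro j
      simp [G', Set.indicator_apply, hi]
  simp_rw [hleft, hright] at key
  rw [← key, integral_indicator_one]
  have : {ω | ∀ k ∈ edge ω, k.1 ∈ A ω → k.2 ∈ B ω → (user k.1 ω, item k.2 ω) ∉ T}
      = ⋂ k, ({ω | k ∈ edge ω}ᶜ ∪ {ω | k.1 ∈ A ω}ᶜ ∪ {ω | k.2 ∈ B ω}ᶜ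
        ∪ (fun ω => (user k.1 ω, item k.2 ω)) ⁻¹' Tᶜ) := by
    ext ω
    simp only [Set.mem_ofPred_eq, Set.mem_iInter, Set.mem_union, Set.mem_compl_iff,
      Set.mem_preimage]
    exact forall_congr' fun k => by tauto
  rw [this]
  exact MeasurableSet.iInter fun k => (((hedge k).compl.union
    (hAB.measurableSet_user k.1).compl).union (hAB.measurableSet_item k.2).compl).union
      (huser k hT.compl)

end IsExchangeableGraphModel

/-! ### Random sets and avoidance probabilities -/

/-- The space of all subsets of `E`, with the σ-algebra generated by the events that the set avoids
a measurable subset of `E`. It is a structure because `Set E` carries a different σ-algebra, the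
product one. -/
structure HitSet (E : Type*) where
  /-- The underlying set. -/
  carrier : Set E

namespace HitSet

variable {E : Type*} [MeasurableSpace E]

/-- The events that a set avoids a measurable set. -/
def avoidEvents (E : Type*) [MeasurableSpace E] : Set (Set (HitSet E)) :=
  {S | ∃ V : Set E, MeasurableSet V ∧ S = {Z : HitSet E | Disjoint Z.carrier V}}

instance : MeasurableSpace (HitSet E) := MeasurableSpace.generateFrom (avoidEvents E)

theorem isPiSystem_avoidEvents : IsPiSystem (avoidEvents E) := by
  rintro _ ⟨V, hV, rfl⟩ _ ⟨V', hV', rfl⟩ -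
  refine ⟨V ∪ V', hV.union hV', ?_⟩
  ext Z
  exact Set.disjoint_union_right.symm

theorem measurableSet_avoid {V : Set E} (hV : MeasurableSet V) :
    MeasurableSet {Z : HitSet E | Disjoint Z.carrier V} :=
  MeasurableSpace.measurableSet_generateFrom ⟨V, hV, rfl⟩

/-- Avoidance probabilities determine the law of a random set. -/
theorem map_eq_of_avoid {Ω Ω' : Type*} [MeasurableSpace Ω] [MeasurableSpace Ω'] {P : Measure Ω}
    {P' : Measure Ω'} [IsProbabilityMeasure P] [IsProbabilityMeasure P']
    {Z : Ω → HitSet E} {Z' : Ω' → HitSet E} (hZ : Measurable Z) (hZ' : Measurable Z')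
    (h : ∀ V : Set E, MeasurableSet V → P {ω | Disjoint (Z ω).carrier V}
      = P' {ω | Disjoint (Z' ω).carrier V}) : P.map Z = P'.map Z' := by
  have := Measure.isProbabilityMeasure_map (μ := P) hZ.aemeasurable
  have := Measure.isProbabilityMeasure_map (μ := P') hZ'.aemeasurable
  refine ext_of_generate_finite _ rfl isPiSystem_avoidEvents ?_ (by simp)
  rintro _ ⟨V, hV, rfl⟩
  rw [Measure.map_apply hZ (measurableSet_avoid hV), Measure.map_apply hZ' (measurableSet_avoid hV)]
  exact h V hV

/-- A set has at least `n` points in its image under `g` iff it hits the preimages of `n` disjoint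
basic open sets. -/
theorem measurableSet_le_encard_image {Y : Type*} [TopologicalSpace Y] [T2Space Y]
    [SecondCountableTopology Y] [MeasurableSpace Y] [OpensMeasurableSpace Y] {g : E → Y}
    (hg : Measurable g) {Q : Set E} (hQ : MeasurableSet Q) (n : ℕ) :
    MeasurableSet {Z : HitSet E | (n : ℕ∞) ≤ (g '' (Z.carrier ∩ Q)).encard} := by
  classical
  let 𝓑 := TopologicalSpace.countableBasis Y
  have : Countable 𝓑 := (TopologicalSpace.countable_countableBasis Y).to_subtype
  have key : {Z : HitSet E | (n : ℕ∞) ≤ (g '' (Z.carrier ∩ Q)).encard}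
      = ⋃ F ∈ {F : Finset 𝓑 | F.card = n ∧ (F : Set 𝓑).PairwiseDisjoint (fun U => (U : Set Y))},
        ⋂ U ∈ F, {Z : HitSet E | Disjoint Z.carrier (Q ∩ g ⁻¹' (U : Set Y))}ᶜ := by
    ext Z
    simp only [Set.mem_ofPred_eq, Set.mem_iUnion, Set.mem_iInter, Set.mem_compl_iff,
      Set.not_disjoint_iff, exists_prop]
    constructor
    · intro h
      obtain ⟨t, ht, htn⟩ := Set.exists_subset_encard_eq h
      have htf : t.Finite := Set.finite_of_encard_eq_coe htn
      obtain ⟨O, hO, hdisj⟩ := htf.t2_separation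
      choose U hUB hyU hUO using fun y : Y =>
        (TopologicalSpace.isBasis_countableBasis Y).exists_subset_of_mem_open (hO y).1 (hO y).2
      have hinj : Set.InjOn (fun y => (⟨U y, hUB y⟩ : 𝓑)) t := by
        intro y hy z hz hyz
        by_contra hne
        have h1 : U y = U z := congrArg Subtype.val hyz
        exact Set.disjoint_left.1 (hdisj hy hz hne) (hUO y (hyU y))
          (hUO z (h1 ▸ hyU y))
      refine ⟨htf.toFinset.image fun y => ⟨U y, hUB y⟩, ⟨?_, ?_⟩, ?_⟩
      · rw [Finset.card_image_of_injOn (by simpa using hinj), ← Set.ncard_eq_toFinset_card t htf,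
          Set.ncard_def, htn]
        rfl
      · intro a ha b hb hab
        simp only [Finset.coe_image, Set.Finite.coe_toFinset, Set.mem_image] at ha hb
        obtain ⟨y, hy, rfl⟩ := ha
        obtain ⟨z, hz, rfl⟩ := hb
        have hne : y ≠ z := fun h => hab (by rw [h])
        exact (hdisj hy hz hne).mono (hUO y) (hUO z)
      · intro V hV
        simp only [Finset.mem_image, Set.Finite.mem_toFinset] at hV
        obtain ⟨y, hy, rfl⟩ := hV
        obtain ⟨e, ⟨heZ, heQ⟩, rfl⟩ := ht hy
        exact ⟨e, heZ, heQ, hyU (g e)⟩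
    · rintro ⟨F, ⟨rfl, hdisj⟩, hF⟩
      rcases F.eq_empty_or_nonempty with rfl | ⟨U₀, hU₀⟩
      · simp
      have : Nonempty E := ⟨(hF U₀ hU₀).choose⟩
      choose! e he using hF
      have hinj : Set.InjOn (fun U => g (e U)) (F : Set 𝓑) := by
        intro U hU V hV hUV
        by_contra hne
        refine Set.disjoint_left.1 (hdisj hU hV hne) (he U hU).2.2 ?_
        have h2 := (he V hV).2.2
        change g (e V) ∈ (V : Set Y) at h2
        change g (e U) ∈ (V : Set Y)
        rwa [show g (e U) = g (e V) from hUV]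
      rw [← Set.encard_coe_eq_coe_finsetCard, ← hinj.encard_image]
      refine Set.encard_le_encard ?_
      rintro _ ⟨U, hU, rfl⟩
      exact ⟨e U, ⟨(he U hU).1, (he U hU).2.1⟩, rfl⟩
  rw [key]
  refine MeasurableSet.biUnion (Set.to_countable _) fun F _ =>
    Finset.measurableSet_biInter F fun U _ => (measurableSet_avoid (hQ.inter (hg ?_))).compl
  exact (TopologicalSpace.isOpen_of_mem_countableBasis U.2).measurableSet

theorem measurable_ncard_image {Y : Type*} [TopologicalSpace Y] [T2Space Y]
    [SecondCountableTopology Y] [MeasurableSpace Y] [OpensMeasurableSpace Y] {g : E → Y}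
    (hg : Measurable g) {Q : Set E} (hQ : MeasurableSet Q) :
    Measurable fun Z : HitSet E => (g '' (Z.carrier ∩ Q)).ncard := by
  have hle := measurableSet_le_encard_image hg hQ
  have h1 : ∀ n : ℕ, MeasurableSet {Z : HitSet E | (g '' (Z.carrier ∩ Q)).encard = n} := by
    intro n
    have : {Z : HitSet E | (g '' (Z.carrier ∩ Q)).encard = n}
        = {Z : HitSet E | (n : ℕ∞) ≤ (g '' (Z.carrier ∩ Q)).encard}
          \ {Z : HitSet E | ((n + 1 : ℕ) : ℕ∞) ≤ (g '' (Z.carrier ∩ Q)).encard} := by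
      ext Z
      simp only [Set.mem_ofPred_eq, Set.mem_sdiff, not_le, Nat.cast_add, Nat.cast_one]
      rw [ENat.lt_add_one_iff (ENat.natCast_ne_top n)]
      exact ⟨fun h => ⟨h.ge, h.le⟩, fun h => le_antisymm h.2 h.1⟩
    rw [this]
    exact (hle n).diff (hle (n + 1))
  have htop : MeasurableSet {Z : HitSet E | (g '' (Z.carrier ∩ Q)).encard = ⊤} := by
    have : {Z : HitSet E | (g '' (Z.carrier ∩ Q)).encard = ⊤}
        = ⋂ n : ℕ, {Z : HitSet E | (n : ℕ∞) ≤ (g '' (Z.carrier ∩ Q)).encard} := by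
      ext Z
      simp only [Set.mem_ofPred_eq, Set.mem_iInter]
      exact ENat.eq_top_iff_forall_ge
    rw [this]
    exact MeasurableSet.iInter hle
  refine measurable_to_countable' fun n => ?_
  have : (fun Z : HitSet E => (g '' (Z.carrier ∩ Q)).ncard) ⁻¹' {n}
      = {Z : HitSet E | (g '' (Z.carrier ∩ Q)).encard = n}
        ∪ {Z : HitSet E | n = 0 ∧ (g '' (Z.carrier ∩ Q)).encard = ⊤} := by
    ext Z
    simp only [Set.mem_preimage, Set.mem_singleton_iff, Set.mem_union, Set.mem_ofPred_eq,
      Set.ncard_def]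
    by_cases h : (g '' (Z.carrier ∩ Q)).encard = ⊤
    · simp [h, eq_comm]
    · lift (g '' (Z.carrier ∩ Q)).encard to ℕ using h with k
      simp
  rw [this]
  refine (h1 n).union ?_
  by_cases hn : n = 0
  · simpa [hn] using htop
  · simp [hn]

/-- The edge density of the bipartite graph with edge set `Z`, restricted to the users with label
`< s` and the items with label `< a`, when vertices are identified with their labels. It is `0` if
there are no such edges or infinitely many. -/
noncomputable def density (s a : ℝ) (Z : HitSet (ℝ × ℝ)) : ℝ :=
  ((Z.carrier ∩ Set.Iio s ×ˢ Set.Iio a).ncard : ℝ)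
    / (((Prod.fst '' (Z.carrier ∩ Set.Iio s ×ˢ Set.Iio a)).ncard : ℝ)
      * ((Prod.snd '' (Z.carrier ∩ Set.Iio s ×ˢ Set.Iio a)).ncard : ℝ))

theorem measurable_density (s a : ℝ) : Measurable (density s a) := by
  have hQ : MeasurableSet (Set.Iio s ×ˢ Set.Iio a : Set (ℝ × ℝ)) :=
    measurableSet_Iio.prod measurableSet_Iio
  have h0 := measurable_ncard_image (measurable_id (α := ℝ × ℝ)) hQ
  simp only [Set.image_id] at h0
  have h1 := measurable_ncard_image (measurable_fst (α := ℝ) (β := ℝ)) hQ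
  have h2 := measurable_ncard_image (measurable_snd (α := ℝ) (β := ℝ)) hQ
  have hc : Measurable fun n : ℕ => (n : ℝ) := Measurable.of_discrete
  exact (hc.comp h0).div ((hc.comp h1).mul (hc.comp h2))

end HitSet

/-! ### The law of the set of edges -/

/-- Selecting all users and all items is `(1, 1)`-sampling. -/
theorem IsSelection.univ {Ω : Type*} [MeasurableSpace Ω] {P : Measure Ω} [IsProbabilityMeasure P]
    {𝒟 : Type*} [MeasurableSpace 𝒟] (D : Ω → 𝒟) :
    IsSelection P 1 1 D (fun _ => Set.univ) (fun _ => Set.univ) where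
  measurableSet_user i := by simp
  measurableSet_item j := by simp
  prob_user i := by simp
  prob_item j := by simp
  indep := by
    have h : (Sum.elim (fun i : ℕ => {ω : Ω | i ∈ (Set.univ : Set ℕ)})
        (fun j : ℕ => {ω : Ω | j ∈ (Set.univ : Set ℕ)})) = fun _ => Set.univ := by
      ext k; rcases k with i | j <;> simp
    rw [h, iIndepSet_iff_meas_biInter fun _ => MeasurableSet.univ]
    intro s
    simp
  indep_data := indepFun_const_left _ D

section LabelEdges

variable {Ω 𝒳 𝒴 : Type*} {user : ℕ → Ω → 𝒳 × ℝ} {item : ℕ → Ω → 𝒴 × ℝ}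
  {edge : Ω → Set (ℕ × ℕ)} {p q : ℝ} {A B : Ω → Set ℕ}

/-- The random set of the pairs of rescaled labels `(p U i, q T j)` of the edges `(i, j)` between
selected vertices. -/
def labelEdges (user : ℕ → Ω → 𝒳 × ℝ) (item : ℕ → Ω → 𝒴 × ℝ) (edge : Ω → Set (ℕ × ℕ)) (p q : ℝ)
    (A B : Ω → Set ℕ) (ω : Ω) : HitSet (ℝ × ℝ) where
  carrier := (fun k : ℕ × ℕ => (p * (user k.1 ω).2, q * (item k.2 ω).2))
    '' (edge ω ∩ A ω ×ˢ B ω)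

theorem setOf_disjoint_labelEdges (V : Set (ℝ × ℝ)) :
    {ω | Disjoint (labelEdges user item edge p q A B ω).carrier V}
      = {ω | ∀ k ∈ edge ω, k.1 ∈ A ω → k.2 ∈ B ω → (user k.1 ω, item k.2 ω) ∉
        {z : (𝒳 × ℝ) × (𝒴 × ℝ) | (p * z.1.2, q * z.2.2) ∈ V}} := by
  ext ω
  simp only [labelEdges, Set.mem_ofPred_eq, Set.disjoint_left, Set.forall_mem_image]
  exact ⟨fun h k h1 h2 h3 => h ⟨h1, h2, h3⟩, fun h k hk => h k hk.1 hk.2.1 hk.2.2⟩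

end LabelEdges

namespace IsExchangeableGraphModel

variable {Ω 𝒳 𝒴 : Type*} [MeasurableSpace Ω] [MeasurableSpace 𝒳]
  [MeasurableSpace 𝒴] {P : Measure Ω} {η : Measure 𝒳} {ν : Measure 𝒴} {W : 𝒳 → 𝒴 → ℝ}
  {user : ℕ → Ω → 𝒳 × ℝ} {item : ℕ → Ω → 𝒴 × ℝ} {edge : Ω → Set (ℕ × ℕ)}
  {p q p' q' : ℝ} {A B A' B' : Ω → Set ℕ}

theorem measurable_labelEdges (hG : IsExchangeableGraphModel P η ν W user item edge)
    (hAB : IsSelection P p q (fun ω => ((fun i => user i ω), (fun j => item j ω), edge ω)) A B) :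
    Measurable (labelEdges user item edge p q A B) := by
  refine measurable_generateFrom ?_
  rintro _ ⟨V, hV, rfl⟩
  have : labelEdges user item edge p q A B ⁻¹' {Z : HitSet (ℝ × ℝ) | Disjoint Z.carrier V}
      = ⋂ k : ℕ × ℕ, ({ω | k ∈ edge ω}ᶜ ∪ {ω | k.1 ∈ A ω}ᶜ ∪ {ω | k.2 ∈ B ω}ᶜ
        ∪ (fun ω => (p * (user k.1 ω).2, q * (item k.2 ω).2)) ⁻¹' Vᶜ) := by
    ext ω
    simp only [labelEdges, Set.mem_ofPred_eq, Set.disjoint_left, Set.forall_mem_image,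
      Set.mem_iInter, Set.mem_union, Set.mem_compl_iff, Set.mem_preimage, Set.mem_inter_iff,
      Set.mem_prod]
    exact forall_congr' fun k => by tauto
  rw [this]
  refine MeasurableSet.iInter fun k => (((hG.measurableSet_edge k.1 k.2).compl.union
    (hAB.measurableSet_user k.1).compl).union (hAB.measurableSet_item k.2).compl).union ?_
  exact ((measurable_const.mul (measurable_snd.comp (hG.measurable_user k.1))).prodMk
    (measurable_const.mul (measurable_snd.comp (hG.measurable_item k.2)))) hV.compl

theorem measureReal_disjoint_labelEdges [IsProbabilityMeasure P]
    (hG : IsExchangeableGraphModel P η ν W user item edge)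
    (hW : Measurable (Function.uncurry W)) (hW01 : ∀ x y, W x y ∈ Set.Icc (0 : ℝ) 1)
    (hAB : IsSelection P p q (fun ω => ((fun i => user i ω), (fun j => item j ω), edge ω)) A B)
    {V : Set (ℝ × ℝ)} (hV : MeasurableSet V) :
    P.real {ω | Disjoint (labelEdges user item edge p q A B ω).carrier V}
      = ∫ ω, expNeg (∫⁻ x, ∫⁻ y, edgeRate W {z | (z.1.2, z.2.2) ∈ V} (x, y)
          ∂(selectedProcess (fun j ω => scaleLabel q (item j ω)) B ω)
          ∂(selectedProcess (fun i ω => scaleLabel p (user i ω)) A ω)) ∂P := by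
  have hV' : MeasurableSet {z : (𝒳 × ℝ) × (𝒴 × ℝ) | (z.1.2, z.2.2) ∈ V} :=
    ((measurable_snd.comp measurable_fst).prodMk (measurable_snd.comp measurable_snd)) hV
  have hm := measurable_edgeRate hW hV'
  have hT : MeasurableSet {z : (𝒳 × ℝ) × (𝒴 × ℝ) | (p * z.1.2, q * z.2.2) ∈ V} :=
    ((measurable_const.mul (measurable_snd.comp measurable_fst)).prodMk
      (measurable_const.mul (measurable_snd.comp measurable_snd))) hV
  rw [setOf_disjoint_labelEdges, hG.measureReal_no_edge hW hW01 hAB hT]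
  congr 1
  ext ω
  congr 1
  have hin : ∀ x, ∫⁻ y, edgeRate W {z | (z.1.2, z.2.2) ∈ V} (x, y)
        ∂(selectedProcess (fun j ω => scaleLabel q (item j ω)) B ω)
      = ∑' j, (B ω).indicator (fun j => edgeRate W {z | (z.1.2, z.2.2) ∈ V}
        (x, scaleLabel q (item j ω))) j :=
    fun x => lintegral_selectedProcess _ _ _ (hm.comp (measurable_const.prodMk measurable_id))
  simp_rw [hin]
  rw [lintegral_selectedProcess]
  · rfl
  · refine Measurable.tsum fun j => ?_
    by_cases hj : j ∈ B ω
    · simp only [Set.indicator_of_mem hj]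
      exact hm.comp (measurable_id.prodMk measurable_const)
    · simp only [Set.indicator_of_notMem hj]
      exact measurable_const

/-- The law of the random set of edges, as pairs of rescaled labels, does not depend on the
selection probabilities. -/
theorem map_labelEdges_eq [IsProbabilityMeasure P] [SigmaFinite η] [SigmaFinite ν]
    (hG : IsExchangeableGraphModel P η ν W user item edge)
    (hW : Measurable (Function.uncurry W)) (hW01 : ∀ x y, W x y ∈ Set.Icc (0 : ℝ) 1)
    (hp : p ∈ Set.Ioc (0 : ℝ) 1) (hq : q ∈ Set.Ioc (0 : ℝ) 1)
    (hAB : IsSelection P p q (fun ω => ((fun i => user i ω), (fun j => item j ω), edge ω)) A B)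
    (hp' : p' ∈ Set.Ioc (0 : ℝ) 1) (hq' : q' ∈ Set.Ioc (0 : ℝ) 1)
    (hAB' : IsSelection P p' q' (fun ω => ((fun i => user i ω), (fun j => item j ω), edge ω))
      A' B') :
    P.map (labelEdges user item edge p q A B) = P.map (labelEdges user item edge p' q' A' B') := by
  refine HitSet.map_eq_of_avoid (hG.measurable_labelEdges hAB) (hG.measurable_labelEdges hAB')
    fun V hV => ?_
  have hV' : MeasurableSet {z : (𝒳 × ℝ) × (𝒴 × ℝ) | (z.1.2, z.2.2) ∈ V} :=
    ((measurable_snd.comp measurable_fst).prodMk (measurable_snd.comp measurable_snd)) hV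
  rw [← measureReal_eq_measureReal_iff, hG.measureReal_disjoint_labelEdges hW hW01 hAB hV,
    hG.measureReal_disjoint_labelEdges hW hW01 hAB' hV]
  have hmu : ∀ (r : ℝ) {C : Ω → Set ℕ}, Measurable C →
      Measurable (selectedProcess (fun i ω => scaleLabel r (user i ω)) C) := fun r C hC =>
    measurable_selectedProcess (fun i => (measurable_scaleLabel r).comp (hG.measurable_user i)) hC
  have hmi : ∀ (r : ℝ) {C : Ω → Set ℕ}, Measurable C →
      Measurable (selectedProcess (fun j ω => scaleLabel r (item j ω)) C) := fun r C hC =>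
    measurable_selectedProcess (fun j => (measurable_scaleLabel r).comp (hG.measurable_item j)) hC
  have hfu : ∀ r ∈ Set.Ioc (0 : ℝ) 1, ∀ (C : Ω → Set ℕ) (S : Set (𝒳 × ℝ)), MeasurableSet S →
      labelIntensity η S < ∞ →
      ∀ᵐ ω ∂P, selectedProcess (fun i ω => scaleLabel r (user i ω)) C ω S < ∞ := by
    intro r hr C S hS hfin
    filter_upwards [hG.poisson_user.ae_lt_top (measurable_scaleLabel r hS)
      (labelIntensity_preimage_scaleLabel_lt_top η hr.1 hS hfin)] with ω hω
    exact (selectedProcess_comp_le user C (measurable_scaleLabel r) ω hS).trans_lt hω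
  have hfi : ∀ r ∈ Set.Ioc (0 : ℝ) 1, ∀ (C : Ω → Set ℕ) (S : Set (𝒴 × ℝ)), MeasurableSet S →
      labelIntensity ν S < ∞ →
      ∀ᵐ ω ∂P, selectedProcess (fun j ω => scaleLabel r (item j ω)) C ω S < ∞ := by
    intro r hr C S hS hfin
    filter_upwards [hG.poisson_item.ae_lt_top (measurable_scaleLabel r hS)
      (labelIntensity_preimage_scaleLabel_lt_top ν hr.1 hS hfin)] with ω hω
    exact (selectedProcess_comp_le item C (measurable_scaleLabel r) ω hS).trans_lt hω
  exact integral_expNeg_lintegral_lintegral_eq (hmu p hAB.measurable_fst)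
    (hmi q hAB.measurable_snd) (hmu p' hAB'.measurable_fst) (hmi q' hAB'.measurable_snd)
    (fun f g hf hg => (hG.integral_expNeg_selectedProcess hp hq hAB hf hg).trans
      (hG.integral_expNeg_selectedProcess hp' hq' hAB' hf hg).symm)
    (labelIntensity η) (labelIntensity ν) (hfu p hp A) (hfi q hq B) (hfu p' hp' A') (hfi q' hq' B')
    (measurable_edgeRate hW hV')

end IsExchangeableGraphModel

/-! ### Distinctness of the labels -/

theorem two_le_pointProcess {Ω E : Type*} [MeasurableSpace E] (x : ℕ → Ω → E) (ω : Ω) {C : Set E}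
    (hC : MeasurableSet C) {i j : ℕ} (hij : i ≠ j) (hi : x i ω ∈ C) (hj : x j ω ∈ C) :
    2 ≤ pointProcess x ω C := by
  rw [pointProcess_apply _ _ hC]
  refine le_trans (le_of_eq ?_) (ENNReal.sum_le_tsum {i, j})
  rw [Finset.sum_pair hij, Set.indicator_of_mem hi, Set.indicator_of_mem hj]
  exact one_add_one_eq_two.symm

/-- Almost surely the labels of a Poisson process are distinct: a window of length `2 K` is covered
by `2 K n` intervals of length `1 / n`, each of which contains two labels with probability of
order `1 / n²`. -/
theorem ae_injective_label {Ω X : Type*} [MeasurableSpace Ω] [MeasurableSpace X] {P : Measure Ω}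
    {η : Measure X} [SigmaFinite η] {x : ℕ → Ω → X × ℝ}
    (hx : IsPoissonProcess (pointProcess x) (labelIntensity η) P) :
    ∀ᵐ ω ∂P, Function.Injective fun i => (x i ω).2 := by
  have key : ∀ m K : ℕ, P {ω | ∃ i j, i ≠ j ∧ (x i ω).1 ∈ spanningSets η m ∧
      (x j ω).1 ∈ spanningSets η m ∧ (x i ω).2 = (x j ω).2 ∧
      (x i ω).2 ∈ Set.Ico (-(K : ℝ)) K} = 0 := by
    intro m K
    set C := spanningSets η m
    have hCm : MeasurableSet C := measurableSet_spanningSets η m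
    have hCfin : η C < ∞ := measure_spanningSets_lt_top η m
    set c : ℝ := (η C).toReal with hc
    have hbound : ∀ n : ℕ, P {ω | ∃ i j, i ≠ j ∧ (x i ω).1 ∈ C ∧
        (x j ω).1 ∈ C ∧ (x i ω).2 = (x j ω).2 ∧
        (x i ω).2 ∈ Set.Ico (-(K : ℝ)) K}
          ≤ ENNReal.ofReal (2 * K * c ^ 2 * (1 / ((n : ℝ) + 1))) := by
      intro n
      set N : ℝ := (n : ℝ) + 1 with hN
      have hNpos : 0 < N := by positivity
      let J : ℤ → Set ℝ := fun k => Set.Ico (k / N) ((k + 1) / N)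
      let R : Finset ℤ := Finset.Ico (-(K * (n + 1) : ℤ)) (K * (n + 1) : ℤ)
      have hJm : ∀ k, MeasurableSet (C ×ˢ J k) := fun k => hCm.prod measurableSet_Ico
      have hJ : ∀ k, labelIntensity η (C ×ˢ J k) ≤ ENNReal.ofReal (c * (1 / N)) := by
        intro k
        rw [labelIntensity, Measure.prod_prod, ENNReal.ofReal_mul ENNReal.toReal_nonneg,
          ENNReal.ofReal_toReal hCfin.ne]
        refine mul_le_mul_right ?_ _
        refine (Measure.restrict_apply_le _ _).trans ?_
        rw [Real.volume_Ico]
        refine ENNReal.ofReal_le_ofReal (le_of_eq ?_)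
        ring
      calc P _ ≤ P (⋃ k ∈ R, {ω | 2 ≤ pointProcess x ω (C ×ˢ J k)}) := by
            refine measure_mono ?_
            rintro ω ⟨i, j, hij, hi, hj, heq, hlo, hhi⟩
            have hfl := Int.floor_le ((x i ω).2 * N)
            have hlt := Int.lt_floor_add_one ((x i ω).2 * N)
            have hmem : (x i ω).2 ∈ J ⌊(x i ω).2 * N⌋ :=
              ⟨(div_le_iff₀ hNpos).2 hfl, (lt_div_iff₀ hNpos).2 hlt⟩
            refine Set.mem_iUnion₂.2 ⟨⌊(x i ω).2 * N⌋, ?_, ?_⟩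
            · refine Finset.mem_Ico.2 ⟨Int.le_floor.2 ?_, Int.floor_lt.2 ?_⟩
              · push_cast
                rw [← neg_mul]
                exact mul_le_mul_of_nonneg_right hlo hNpos.le
              · push_cast
                exact mul_lt_mul_of_pos_right hhi hNpos
            · exact two_le_pointProcess x ω (hJm _) hij ⟨hi, hmem⟩ ⟨hj, heq ▸ hmem⟩
        _ ≤ ∑ k ∈ R, P {ω | 2 ≤ pointProcess x ω (C ×ˢ J k)} := measure_biUnion_finset_le _ _
        _ ≤ ∑ k ∈ R, ENNReal.ofReal ((c * (1 / N)) ^ 2) := by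
            refine Finset.sum_le_sum fun k _ => ?_
            rw [ENNReal.ofReal_pow (by positivity)]
            exact (hx.measure_two_le (hJm k) ((hJ k).trans_lt ENNReal.ofReal_lt_top)).trans
              (pow_le_pow_left' (hJ k) 2)
        _ = ENNReal.ofReal (2 * K * c ^ 2 * (1 / N)) := by
            have hcard : (R.card : ℝ) = 2 * K * N := by
              have : (R.card : ℤ) = 2 * K * (n + 1) := by
                simp only [R, Int.card_Ico]
                rw [Int.toNat_of_nonneg (by
                  have : (0 : ℤ) ≤ K * (n + 1) := by positivity
                  linarith)]
                ring
              rw [hN]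
              exact_mod_cast this
            rw [Finset.sum_const, nsmul_eq_mul, ← ENNReal.ofReal_natCast,
              ← ENNReal.ofReal_mul (by positivity), hcard]
            congr 1
            field_simp
    have hlim : Tendsto (fun n : ℕ => ENNReal.ofReal (2 * K * c ^ 2 * (1 / ((n : ℝ) + 1)))) atTop
        (𝓝 0) := by
      have := (tendsto_one_div_add_atTop_nhds_zero_nat (𝕜 := ℝ)).const_mul (2 * K * c ^ 2)
      simpa using ENNReal.tendsto_ofReal this
    exact le_antisymm (ge_of_tendsto' hlim hbound) zero_le
  have hae : ∀ᵐ ω ∂P, ∀ m K : ℕ, ¬ ∃ i j, i ≠ j ∧ (x i ω).1 ∈ spanningSets η m ∧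
      (x j ω).1 ∈ spanningSets η m ∧ (x i ω).2 = (x j ω).2 ∧
      (x i ω).2 ∈ Set.Ico (-(K : ℝ)) K :=
    ae_all_iff.2 fun m => ae_all_iff.2 fun K => by simpa [ae_iff] using key m K
  filter_upwards [hae] with ω hω i j hij
  by_contra hne
  obtain ⟨K, hK⟩ := exists_nat_gt |(x i ω).2|
  have hK' := abs_lt.1 hK
  refine hω (max (spanningSetsIndex η (x i ω).1) (spanningSetsIndex η (x j ω).1)) K
    ⟨i, j, hne, ?_, ?_, hij, hK'.1.le, hK'.2⟩
  · exact mem_spanningSets_of_index_le η _ (le_max_left _ _)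
  · exact mem_spanningSets_of_index_le η _ (le_max_right _ _)

/-! ### Edge densities and their limits -/

theorem BipartiteGraph.edgeDensity_dropIsolated {α β : Type*} (g : BipartiteGraph α β) :
    g.dropIsolated.edgeDensity = (g.edges.ncard : ℝ)
      / (((Prod.fst '' g.edges).ncard : ℝ) * ((Prod.snd '' g.edges).ncard : ℝ)) := by
  have h1 : g.dropIsolated.users = Prod.fst '' g.edges := by
    ext u
    simp only [dropIsolated, Set.mem_ofPred_eq, Set.mem_image, Prod.exists, exists_and_right,
      exists_eq_right]
    exact ⟨fun h => h.2, fun ⟨v, h⟩ => ⟨(g.edges_subset h).1, v, h⟩⟩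
  have h2 : g.dropIsolated.items = Prod.snd '' g.edges := by
    ext v
    simp only [dropIsolated, Set.mem_ofPred_eq, Set.mem_image, Prod.exists, exists_eq_right]
    exact ⟨fun h => h.2, fun ⟨u, h⟩ => ⟨(g.edges_subset h).2, u, h⟩⟩
  rw [edgeDensity, h1, h2]
  rfl

/-- If the labels are distinct, the edge density of a sampled graph is that of the random set of
its edges as pairs of rescaled labels. -/
theorem edgeDensity_sample_graphProcess {Ω 𝒳 𝒴 : Type*} {user : ℕ → Ω → 𝒳 × ℝ}
    {item : ℕ → Ω → 𝒴 × ℝ} (edge : Ω → Set (ℕ × ℕ)) {p q : ℝ} (hp : 0 < p) (hq : 0 < q)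
    (A B : Ω → Set ℕ) (s a : ℝ) {ω : Ω} (hu : Function.Injective fun i => (user i ω).2)
    (hi : Function.Injective fun j => (item j ω).2) :
    ((graphProcess user item edge s a ω).sample (A ω) (B ω)).edgeDensity
      = HitSet.density (p * s) (q * a) (labelEdges user item edge p q A B ω) := by
  set S : Set (ℕ × ℕ) := (edge ω ∩ {i | (user i ω).2 < s} ×ˢ {j | (item j ω).2 < a})
    ∩ A ω ×ˢ B ω with hS
  have hu' : Function.Injective fun i => p * (user i ω).2 :=
    (mul_right_injective₀ hp.ne').comp hu
  have hi' : Function.Injective fun j => q * (item j ω).2 :=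
    (mul_right_injective₀ hq.ne').comp hi
  have hφ : Function.Injective fun k : ℕ × ℕ => (p * (user k.1 ω).2, q * (item k.2 ω).2) :=
    hu'.prodMap hi'
  have hZ : (labelEdges user item edge p q A B ω).carrier ∩ Set.Iio (p * s) ×ˢ Set.Iio (q * a)
      = (fun k : ℕ × ℕ => (p * (user k.1 ω).2, q * (item k.2 ω).2)) '' S := by
    ext z
    simp only [labelEdges, Set.mem_inter_iff, Set.mem_image, Set.mem_prod, Set.mem_Iio, hS,
      Set.mem_ofPred_eq]
    constructor
    · rintro ⟨⟨k, ⟨he, hk⟩, rfl⟩, h1, h2⟩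
      exact ⟨k, ⟨⟨he, lt_of_mul_lt_mul_left h1 hp.le, lt_of_mul_lt_mul_left h2 hq.le⟩, hk⟩, rfl⟩
    · rintro ⟨k, ⟨⟨he, h1, h2⟩, hk⟩, rfl⟩
      exact ⟨⟨k, ⟨he, hk⟩, rfl⟩, mul_lt_mul_of_pos_left h1 hp, mul_lt_mul_of_pos_left h2 hq⟩
  have hfst : Prod.fst '' ((fun k : ℕ × ℕ => (p * (user k.1 ω).2, q * (item k.2 ω).2)) '' S)
      = (fun i => p * (user i ω).2) '' (Prod.fst '' S) := by
    rw [Set.image_image, Set.image_image]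
  have hsnd : Prod.snd '' ((fun k : ℕ × ℕ => (p * (user k.1 ω).2, q * (item k.2 ω).2)) '' S)
      = (fun j => q * (item j ω).2) '' (Prod.snd '' S) := by
    rw [Set.image_image, Set.image_image]
  rw [BipartiteGraph.sample, BipartiteGraph.edgeDensity_dropIsolated, HitSet.density, hZ, hfst,
    hsnd, Set.ncard_image_of_injective _ hφ, Set.ncard_image_of_injective _ hu',
    Set.ncard_image_of_injective _ hi']
  rfl

theorem BipartiteGraph.sample_univ_dropIsolated {α β : Type*} (g : BipartiteGraph α β) :
    g.dropIsolated.sample Set.univ Set.univ = g.dropIsolated := by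
  ext x
  · simp only [sample, induce, dropIsolated, Set.inter_univ, Set.univ_prod_univ]
    simp
  · simp only [sample, induce, dropIsolated, Set.inter_univ, Set.univ_prod_univ]
    simp
  · simp [sample, induce, dropIsolated]

theorem exists_rat_lt_of_finite {T : Set ℝ} (hT : T.Finite) {m s : ℝ} (hm : m < s)
    (h : ∀ t ∈ T, t < s) : ∃ r : ℚ, m < r ∧ (r : ℝ) < s ∧ ∀ t ∈ T, t < r := by
  obtain ⟨t, ht, hmax⟩ := Set.exists_max_image (insert m T) id (hT.insert m)
    ⟨m, Set.mem_insert _ _⟩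
  have hts : t < s := by
    rcases ht with rfl | ht
    · exact hm
    · exact h t ht
  obtain ⟨r, hr1, hr2⟩ := exists_rat_btwn hts
  exact ⟨r, (hmax m (Set.mem_insert _ _)).trans_lt hr1, hr2,
    fun u hu => (hmax u (Set.mem_insert_of_mem _ hu)).trans_lt hr1⟩

namespace HitSet

/-- Convergence of the density along rational sizes, an event that is visibly measurable. -/
def TendstoRat (c : ℝ) (Z : HitSet (ℝ × ℝ)) : Prop :=
  ∀ n : ℕ, ∃ N : ℕ, ∀ s a : ℚ, (N : ℚ) ≤ s → (N : ℚ) ≤ a → |density s a Z - c| ≤ 1 / ((n : ℝ) + 1)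

theorem measurableSet_tendstoRat (c : ℝ) : MeasurableSet {Z | TendstoRat c Z} := by
  have : {Z | TendstoRat c Z} = ⋂ n : ℕ, ⋃ N : ℕ, ⋂ s : ℚ, ⋂ a : ℚ, ⋂ _ : (N : ℚ) ≤ s,
      ⋂ _ : (N : ℚ) ≤ a, {Z | |density s a Z - c| ≤ 1 / ((n : ℝ) + 1)} := by
    ext Z
    simp only [TendstoRat, Set.mem_ofPred_eq, Set.mem_iInter, Set.mem_iUnion]
  rw [this]
  refine MeasurableSet.iInter fun n => MeasurableSet.iUnion fun N => MeasurableSet.iInter fun s =>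
    MeasurableSet.iInter fun a => MeasurableSet.iInter fun _ => MeasurableSet.iInter fun _ => ?_
  exact measurableSet_le ((measurable_density s a).sub_const c).abs measurable_const

theorem tendstoRat_of_tendsto {c : ℝ} {Z : HitSet (ℝ × ℝ)}
    (h : Tendsto (fun z : ℝ × ℝ => density z.1 z.2 Z) (atTop ×ˢ atTop) (𝓝 c)) :
    TendstoRat c Z := by
  intro n
  have hn : (0 : ℝ) < 1 / ((n : ℝ) + 1) := by positivity
  have := (Metric.tendsto_nhds.1 h) _ hn
  rw [prod_atTop_atTop_eq, eventually_atTop] at this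
  obtain ⟨⟨s₀, a₀⟩, h0⟩ := this
  obtain ⟨N, hN⟩ := exists_nat_ge (max s₀ a₀)
  refine ⟨N, fun s a hs ha => ?_⟩
  have hs' : (N : ℝ) ≤ s := by exact_mod_cast hs
  have ha' : (N : ℝ) ≤ a := by exact_mod_cast ha
  exact (h0 ((s : ℝ), (a : ℝ)) ⟨((le_max_left _ _).trans hN).trans hs',
    ((le_max_right _ _).trans hN).trans ha'⟩).le

/-- Convergence along rational sizes to a nonzero limit implies convergence: the sets involved are
finite, so that the density at real sizes is attained at slightly smaller rational sizes. -/
theorem TendstoRat.tendsto {c : ℝ} (hc : 0 < c) {Z : HitSet (ℝ × ℝ)} (h : TendstoRat c Z) :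
    Tendsto (fun z : ℝ × ℝ => density z.1 z.2 Z) (atTop ×ˢ atTop) (𝓝 c) := by
  -- A positive density forces the number of edges to be finite, since `ncard` of an infinite set
  -- is `0`.
  have hfin : ∃ N : ℕ, ∀ s a : ℚ, (N : ℚ) ≤ s → (N : ℚ) ≤ a →
      (Z.carrier ∩ Set.Iio (s : ℝ) ×ˢ Set.Iio (a : ℝ)).Finite := by
    obtain ⟨n, hn⟩ := exists_nat_one_div_lt hc
    obtain ⟨N, hN⟩ := h n
    refine ⟨N, fun s a hs ha => Set.finite_of_ncard_ne_zero fun h0 => ?_⟩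
    have h1 := (hN s a hs ha).trans_lt hn
    rw [density, h0] at h1
    simp only [Nat.cast_zero, zero_div, zero_sub, abs_neg, abs_of_pos hc] at h1
    exact lt_irrefl _ h1
  obtain ⟨N₀, hN₀⟩ := hfin
  rw [Metric.tendsto_nhds]
  intro ε hε
  obtain ⟨n, hn⟩ := exists_nat_one_div_lt hε
  obtain ⟨N, hN⟩ := h n
  rw [prod_atTop_atTop_eq, eventually_atTop]
  -- At real sizes `z`, the finitely many edges all have labels below some rational sizes `s, a`
  -- that are smaller than `z`.
  refine ⟨((max N N₀ : ℝ) + 1, (max N N₀ : ℝ) + 1), fun z hz => ?_⟩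
  have hz1 : (max N N₀ : ℝ) < z.1 := (lt_add_one _).trans_le hz.1
  have hz2 : (max N N₀ : ℝ) < z.2 := (lt_add_one _).trans_le hz.2
  obtain ⟨s₁, hs₁⟩ := exists_rat_gt z.1
  obtain ⟨a₁, ha₁⟩ := exists_rat_gt z.2
  have hle : ∀ {r : ℚ}, (max N N₀ : ℝ) < r → (N : ℚ) ≤ r ∧ (N₀ : ℚ) ≤ r := fun hr =>
    ⟨by exact_mod_cast ((le_max_left _ _).trans_lt hr).le,
      by exact_mod_cast ((le_max_right _ _).trans_lt hr).le⟩
  have hS : (Z.carrier ∩ Set.Iio z.1 ×ˢ Set.Iio z.2).Finite :=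
    (hN₀ s₁ a₁ (hle (hz1.trans hs₁)).2 (hle (hz2.trans ha₁)).2).subset
      (Set.inter_subset_inter_right _ (Set.prod_mono (Set.Iio_subset_Iio hs₁.le)
        (Set.Iio_subset_Iio ha₁.le)))
  obtain ⟨s, hs1, hs2, hs3⟩ := exists_rat_lt_of_finite (hS.image Prod.fst) hz1
    (by rintro _ ⟨w, hw, rfl⟩; exact hw.2.1)
  obtain ⟨a, ha1, ha2, ha3⟩ := exists_rat_lt_of_finite (hS.image Prod.snd) hz2
    (by rintro _ ⟨w, hw, rfl⟩; exact hw.2.2)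
  have heq : Z.carrier ∩ Set.Iio z.1 ×ˢ Set.Iio z.2
      = Z.carrier ∩ Set.Iio (s : ℝ) ×ˢ Set.Iio (a : ℝ) := by
    refine Set.Subset.antisymm (fun w hw => ⟨hw.1, hs3 _ ⟨w, hw, rfl⟩, ha3 _ ⟨w, hw, rfl⟩⟩) ?_
    exact Set.inter_subset_inter_right _ (Set.prod_mono (Set.Iio_subset_Iio hs2.le)
        (Set.Iio_subset_Iio ha2.le))
  have hd : density z.1 z.2 Z = density s a Z := by simp only [density, heq]
  rw [hd, Real.dist_eq]
  exact (hN s a (hle hs1).1 (hle ha1).1).trans_lt hn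

end HitSet

theorem mainTheorem1
    {Ω 𝒳 𝒴 : Type*} [MeasurableSpace Ω] [MeasurableSpace 𝒳] [MeasurableSpace 𝒴]
    (P : Measure Ω) [IsProbabilityMeasure P]
    (η : Measure 𝒳) [SigmaFinite η] (ν : Measure 𝒴) [SigmaFinite ν]
    (W : 𝒳 → 𝒴 → ℝ) (hW : Measurable (Function.uncurry W))
    (hW01 : ∀ x y, W x y ∈ Set.Icc (0 : ℝ) 1)
    (user : ℕ → Ω → 𝒳 × ℝ) (item : ℕ → Ω → 𝒴 × ℝ) (edge : Ω → Set (ℕ × ℕ))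
    (hG : IsExchangeableGraphModel P η ν W user item edge)
    (hdense : IsDenseProcess P (graphProcess user item edge))
    (p q : ℝ) (hp : p ∈ Set.Ioc (0 : ℝ) 1) (hq : q ∈ Set.Ioc (0 : ℝ) 1)
    (A B : Ω → Set ℕ)
    (hAB : IsSelection P p q
      (fun ω => ((fun i => user i ω), (fun j => item j ω), edge ω)) A B) :
    ∀ᵐ ω ∂P, Tendsto
      (fun z : ℝ × ℝ =>
        ((graphProcess user item edge z.1 z.2 ω).sample (A ω) (B ω)).edgeDensity /
          (graphProcess user item edge z.1 z.2 ω).edgeDensity)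
      (atTop ×ˢ atTop) (𝓝 1) := by
  obtain ⟨c, hc, hlim⟩ := hdense
  have hone : (1 : ℝ) ∈ Set.Ioc (0 : ℝ) 1 := ⟨one_pos, le_rfl⟩
  have huniv := IsSelection.univ (P := P)
    (fun ω => ((fun i => user i ω), (fun j => item j ω), edge ω))
  have hu := ae_injective_label hG.poisson_user
  have hi := ae_injective_label hG.poisson_item
  have hfull : ∀ᵐ ω ∂P, HitSet.TendstoRat c
      (labelEdges user item edge 1 1 (fun _ => Set.univ) (fun _ => Set.univ) ω) := by
    filter_upwards [hlim, hu, hi] with ω hω hu hi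
    refine HitSet.tendstoRat_of_tendsto (hω.congr fun z => ?_)
    have := edgeDensity_sample_graphProcess edge one_pos one_pos (fun _ => Set.univ)
      (fun _ => Set.univ) z.1 z.2 hu hi
    rw [graphProcess, BipartiteGraph.sample_univ_dropIsolated, one_mul, one_mul] at this
    exact this
  have hsampled : ∀ᵐ ω ∂P, HitSet.TendstoRat c (labelEdges user item edge p q A B ω) := by
    have h1 := (ae_map_iff (hG.measurable_labelEdges huniv).aemeasurable
      (HitSet.measurableSet_tendstoRat c)).2 hfull
    rw [← hG.map_labelEdges_eq hW hW01 hp hq hAB hone hone huniv] at h1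
    exact ae_of_ae_map (hG.measurable_labelEdges hAB).aemeasurable h1
  have hscale : Tendsto (fun z : ℝ × ℝ => (p * z.1, q * z.2)) (atTop ×ˢ atTop)
      (atTop ×ˢ atTop) :=
    (tendsto_id.const_mul_atTop hp.1).prodMap (tendsto_id.const_mul_atTop hq.1)
  filter_upwards [hlim, hsampled, hu, hi] with ω hω hs hu hi
  have hnum : Tendsto (fun z : ℝ × ℝ =>
      ((graphProcess user item edge z.1 z.2 ω).sample (A ω) (B ω)).edgeDensity)
      (atTop ×ˢ atTop) (𝓝 c) :=
    ((hs.tendsto hc).comp hscale).congr fun z =>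
      (edgeDensity_sample_graphProcess edge hp.1 hq.1 A B z.1 z.2 hu hi).symm
  have := hnum.div hω hc.ne'
  rwa [div_self hc.ne'] at this
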